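/- **Setting.** Let $p\ge 1$ and let $H_o=N(\mathbf 0,\mathbf I_{p+1})$ be the law of $(y,\mathbf x)\in\mathbb R\times\mathbb R^p$ (Gaussian regression model with true intercept and slopes $0$). For $0\le\varepsilon\le 1$ let $V_\varepsilon=\{(1-\varepsilon)H_o+\varepsilon H^* : H^* \text{ a probability distribution on } \mathbb R^{p+1}\}$. An estimating functional $\mathbf T$ assigns to a distribution $H$ a pair $(t(H),\mathbf T(H))$ of intercept and slopes, or is undefined at $H$; its bias is $b(\mathbf T,H)=\|\mathbf T(H)\|$ (Euclidean norm), or $\infty$ if it is undefined at $H$, and its maximum bias function is $B_{\mathbf T}(\varepsilon)=\sup_{H\in V_\varepsilon}b(\mathbf T,H)$. One functional *dominates* another if its maximum bias function is $\le$ the other's for all $\varepsilon\in[0,1]$ and is strictly smaller for some $\varepsilon\in(0,1)$. Let $\rho:\mathbb R\to\mathbb R$ be symmetric, nondecreasing on $[0,\infty)$, with $\rho(0)=0$, $\lim_{u\to\infty}\rho(u)=1$ and finitely many discontinuities (A3), and let $0<b<1$. For $(\alpha,\boldsymbol\theta)\in\mathbb R\times\mathbb R^p$ call $\sigma>0$ feasible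 at $(\alpha,\boldsymbol\theta)$ if $E_H\rho((y-\alpha-\mathbf x'\boldsymbol\theta)/\sigma)\le b$. An *S-estimate* is a functional whose value at $H$ minimizes over $(\alpha,\boldsymbol\theta)$ the infimum of the feasible $\sigma$, the minimum being required to lie in $(0,\infty)$; a *CM-estimate* with tuning constant $c>0$ is one whose value at $H$ minimizes over $(\alpha,\boldsymbol\theta)$ the infimum over the feasible $\sigma$ of $c\,E_H\rho((y-\alpha-\mathbf x'\boldsymbol\theta)/\sigma)+\log\sigma$, the minimum being required to be finite. Each is undefined at $H$ exactly when no minimizer exists; where there are several, any choice is allowed. The S-estimate (for $\rho,b$) is called *bias-inadmissible* if for some $c>0$ the CM-estimate for the same $\rho,b$ with constant $c$ dominates it, whatever minimizers are chosen. For $Z\sim N(0,1)$ and $s>0$ put $g(s)=E\rho(Z/s)$, $\phi(s)=-s g'(s)$, $\sigma_{b,\varepsilon}=g^{-1}\big(\tfrac{b-\varepsilon}{1-\varepsilon}\big)$, $\gamma_{b,\varepsilon}=g^{-1}\big(\tfrac{b}{1-\varepsilon}\big)$, $c(\varepsilon)=\varepsilon^{-1}\log(\sigma_{b,\varepsilon}/\gamma_{b,\varepsilon})$,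 and $c_o=\inf c(\varepsilon)$ over the $\varepsilon\in(0,b)$ for which both inverses exist. **Theorem.** Let $\rho$ satisfy A3 and let $0<b<1$. Suppose (A4) that $g$ is continuously differentiable on $(0,\infty)$ and that $\phi$ is unimodal: nondecreasing on $(0,\sigma_M]$, nonincreasing on $[\sigma_M,\infty)$, with its maximum attained only at $\sigma_M>0$. Suppose further that $g(\sigma_M)<b$, that $g$ is convex on $(0,\infty)$, and that $$\phi(\sigma_{b,0})\ \ge\ \frac{[1-g(\sigma_M)]^2(1-b)}{2-[b+g(\sigma_M)]}.$$ Then $\sigma_{b,0}=g^{-1}(b)\in(0,\infty)$ exists, $c_o=1/\phi(\sigma_{b,0})$, and with $$c_1=\frac{\log(\sigma_M/\sigma_{b,0})}{b-g(\sigma_M)}$$ we have $0<c_1<c_o$; and for every $c$ with $c_1<c\le c_o$ the CM-estimate with constant $c$ dominates the S-estimate based on the same $\rho$ and $b$: $B_{CM}(\varepsilon)\le B_S(\varepsilon)$ for all $\varepsilon\in[0,1]$, with strict inequality for some $\varepsilon\in(0,1)$. This holds for any choice of the minimizers. In particular, the S-estimate is bias-inadmissible. Moreover, for every $\alpha$ with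 $0<\alpha<P(|Z|<1)\approx 0.6827$ the $\alpha$-quantile regression estimate, that is, the S-estimate with $\rho(u)=I\{|u|\ge 1\}$ and $b=1-\alpha$, is bias-inadmissible; in particular so is the least median of squares estimate ($\alpha=b=1/2$). -/

import Mathlib

open MeasureTheory ProbabilityTheory Set Filter
open scoped ENNReal Topology

noncomputable section

namespace RobustReg

/-- Conditions on the loss function `ρ`: symmetric, nondecreasing on `[0, ∞)`, `ρ 0 = 0`,
limit `1` at infinity (hence `0 ≤ ρ ≤ 1`), finitely many discontinuities. -/
structure IsLoss (ρ : ℝ → ℝ) : Prop where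
  symm : ∀ u, ρ (-u) = ρ u
  mono : MonotoneOn ρ (Ici 0)
  zero : ρ 0 = 0
  lim : Tendsto ρ atTop (𝓝 1)
  finite_disc : {u : ℝ | ¬ ContinuousAt ρ u}.Finite

/-! ### The regression model and contamination -/

/-- The space of regressors `ℝ^p`, with the Euclidean norm. -/
abbrev Reg (p : ℕ) : Type := EuclideanSpace ℝ (Fin p)

/-- An observation `(y, x)`: response and regressors. -/
abbrev Obs (p : ℕ) : Type := ℝ × Reg p

/-- A regression parameter `(α, θ)`: intercept and slopes. -/
abbrev Par (p : ℕ) : Type := ℝ × Reg p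

/-- The residual `y - α - x'θ`. -/
def resid {p : ℕ} (z : Par p) (w : Obs p) : ℝ := w.1 - z.1 - inner ℝ w.2 z.2

/-- The Gaussian model `H₀ = N(0, I_{p+1})` for `(y, x)`; the true parameters are zero. -/
def gaussModel (p : ℕ) : Measure (Obs p) := (gaussianReal 0 1).prod (stdGaussian (Reg p))

/-- The `ε`-contamination neighbourhood of `H₀`: all `(1 - ε) H₀ + ε H*`, where `H*` is an
arbitrary probability distribution on `ℝ × ℝ^p`. -/
def contNbhd (p : ℕ) (ε : ℝ) : Set (Measure (Obs p)) :=
  {H | ∃ Hs : Measure (Obs p), IsProbabilityMeasure Hs ∧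
    H = ENNReal.ofReal (1 - ε) • gaussModel p + ENNReal.ofReal ε • Hs}

/-- A (partially defined) estimating functional: `T H = none` where the estimate does not exist,
`T H = some (α, θ)` otherwise. -/
abbrev Functional (p : ℕ) : Type := Measure (Obs p) → Option (Par p)

/-- The asymptotic bias of the slopes at `H`: the Euclidean norm of the slope part (the true slope
being zero), and `∞` where the functional is not defined. -/
def bias {p : ℕ} (T : Functional p) (H : Measure (Obs p)) : ℝ≥0∞ :=
  match T H with
  | none => ⊤
  | some z => ENNReal.ofReal ‖z.2‖

/-- The maximum bias function `B_T(ε) = sup {b(T, H) : H ∈ V_ε}`. -/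
def maxBias {p : ℕ} (T : Functional p) (ε : ℝ) : ℝ≥0∞ := ⨆ H ∈ contNbhd p ε, bias T H

/-- `T` dominates `T'` with respect to maximum bias: its maximum bias function is never larger
and it is smaller at some contamination level. -/
def Dominates {p : ℕ} (T T' : Functional p) : Prop :=
  (∀ ε ∈ Icc (0 : ℝ) 1, maxBias T ε ≤ maxBias T' ε) ∧
    ∃ ε ∈ Ioo (0 : ℝ) 1, maxBias T ε < maxBias T' ε

/-! ### S-estimates and CM-estimates -/

/-- `E_H ρ((y - α - x'θ)/σ)`. -/
def expLoss {p : ℕ} (ρ : ℝ → ℝ) (H : Measure (Obs p)) (z : Par p) (σ : ℝ) : ℝ :=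
  ∫ w, ρ (resid z w / σ) ∂H

/-- The scales `σ > 0` that satisfy the constraint `E_H ρ((y - α - x'θ)/σ) ≤ b` at `(α, θ)`. -/
def feasible {p : ℕ} (ρ : ℝ → ℝ) (b : ℝ) (H : Measure (Obs p)) (z : Par p) : Set ℝ :=
  {σ | 0 < σ ∧ expLoss ρ H z σ ≤ b}

/-- The M-scale of the residuals at `(α, θ)`: the infimum of the feasible scales (`∞` if there are
none). -/
def sObj {p : ℕ} (ρ : ℝ → ℝ) (b : ℝ) (H : Measure (Obs p)) (z : Par p) : ℝ≥0∞ :=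
  ⨅ σ ∈ feasible ρ b H z, ENNReal.ofReal σ

/-- The CM objective at `(α, θ)`, profiled over the scale: the infimum over the feasible `σ` of
`c E_H ρ((y - α - x'θ)/σ) + log σ`. -/
def cmObj {p : ℕ} (ρ : ℝ → ℝ) (b c : ℝ) (H : Measure (Obs p)) (z : Par p) : EReal :=
  ⨅ σ ∈ feasible ρ b H z, ((c * expLoss ρ H z σ + Real.log σ : ℝ) : EReal)

/-- `(α, θ)` solves the S-problem at `H`: it minimizes the residual M-scale, and the minimal scale
lies in `(0, ∞)`. -/
def IsSSol {p : ℕ} (ρ : ℝ → ℝ) (b : ℝ) (H : Measure (Obs p)) (z : Par p) : Prop :=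
  sObj ρ b H z ≠ 0 ∧ sObj ρ b H z ≠ ⊤ ∧ ∀ z', sObj ρ b H z ≤ sObj ρ b H z'

/-- `(α, θ)` solves the CM-problem at `H`: it minimizes the CM objective, and the minimal value is
finite. -/
def IsCMSol {p : ℕ} (ρ : ℝ → ℝ) (b c : ℝ) (H : Measure (Obs p)) (z : Par p) : Prop :=
  cmObj ρ b c H z ≠ ⊥ ∧ cmObj ρ b c H z ≠ ⊤ ∧ ∀ z', cmObj ρ b c H z ≤ cmObj ρ b c H z'

/-- `T` picks, at every probability distribution `H`, a solution of the given problem,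
and is undefined exactly where there is no solution. -/
def Selects {p : ℕ} (Sol : Measure (Obs p) → Par p → Prop) (T : Functional p) : Prop :=
  ∀ H : Measure (Obs p), IsProbabilityMeasure H →
    (∀ z, T H = some z → Sol H z) ∧ (T H = none → ∀ z, ¬ Sol H z)

/-- `T` is an S-functional of regression based on `ρ` and `b`. -/
def IsSFunctional {p : ℕ} (ρ : ℝ → ℝ) (b : ℝ) (T : Functional p) : Prop :=
  Selects (IsSSol ρ b) T

/-- `T` is a CM-functional of regression based on `ρ` and `b`, with tuning constant `c`. -/
def IsCMFunctional {p : ℕ} (ρ : ℝ → ℝ) (b c : ℝ) (T : Functional p) : Prop :=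
  Selects (IsCMSol ρ b c) T

/-- In dimension `p`, the CM-estimate based on `ρ`, `b`, `c` dominates the S-estimate based on the
same `ρ`, `b`, for all choices of the solutions. -/
def CMDominatesS (p : ℕ) (ρ : ℝ → ℝ) (b c : ℝ) : Prop :=
  ∀ TS TCM : Functional p, IsSFunctional ρ b TS → IsCMFunctional ρ b c TCM → Dominates TCM TS

/-- The S-estimate based on `ρ`, `b` is bias-inadmissible: it is dominated by a CM-estimate based
on the same `ρ`, `b`. -/
def SInadmissible (p : ℕ) (ρ : ℝ → ℝ) (b : ℝ) : Prop := ∃ c : ℝ, 0 < c ∧ CMDominatesS p ρ b c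

/-! ### Quantities of the Gaussian model -/

/-- `g(s) = E ρ(Z/s)`, `Z` standard normal (used for `s > 0`). -/
def g (ρ : ℝ → ℝ) (s : ℝ) : ℝ := ∫ z, ρ (z / s) ∂(gaussianReal 0 1)

/-- `φ(s) = -s g'(s)`. -/
def phi (ρ : ℝ → ℝ) (s : ℝ) : ℝ := -s * deriv (g ρ) s

/-- The inverse of `g` on `(0, ∞)` (used at values that `g` takes there). -/
def gInv (ρ : ℝ → ℝ) (v : ℝ) : ℝ := Function.invFunOn (g ρ) (Ioi 0) v

/-- `σ_{b,ε} = g⁻¹((b - ε)/(1 - ε))`. -/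
def sigma (ρ : ℝ → ℝ) (b ε : ℝ) : ℝ := gInv ρ ((b - ε) / (1 - ε))

/-- `γ_{b,ε} = g⁻¹(b/(1 - ε))`. -/
def gam (ρ : ℝ → ℝ) (b ε : ℝ) : ℝ := gInv ρ (b / (1 - ε))

/-- The set of all values `c(ε) = ε⁻¹ log(σ_{b,ε}/γ_{b,ε})`, `0 < ε < b`, over the `ε` for which
`σ_{b,ε}` and `γ_{b,ε}` exist; its infimum is `c_o`. -/
def cSet (ρ : ℝ → ℝ) (b : ℝ) : Set ℝ :=
  {r | ∃ ε, 0 < ε ∧ ε < b ∧ (b - ε) / (1 - ε) ∈ g ρ '' Ioi 0 ∧ b / (1 - ε) ∈ g ρ '' Ioi 0 ∧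
    r = ε⁻¹ * Real.log (sigma ρ b ε / gam ρ b ε)}

/-- `g` is continuously differentiable on `(0, ∞)` and `φ` is unimodal there, with its maximum
attained (only) at `σM`. -/
structure IsUnimodalAt (ρ : ℝ → ℝ) (σM : ℝ) : Prop where
  pos : 0 < σM
  smooth : ContDiffOn ℝ 1 (g ρ) (Ioi 0)
  incr : MonotoneOn (phi ρ) (Ioc 0 σM)
  decr : AntitoneOn (phi ρ) (Ici σM)
  max : ∀ s, 0 < s → s ≠ σM → phi ρ s < phi ρ σM

/-- The loss function `I{|u| ≥ 1}` of the quantile estimates. -/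
def quantLoss : ℝ → ℝ := indicator {u : ℝ | 1 ≤ |u|} (fun _ => 1)

end RobustReg

end

noncomputable section

namespace RobustReg

/-! ### Loss functions -/

/-! Write τ = √(1 + ‖θ‖²) (`resScale`), γ = γ_{b,ε}, σ = σ_{b,ε} and s₀ = g⁻¹(b). Under the model
the residual at (α, θ) is normal with standard deviation τ, and a nonzero mean only increases the
expected loss; hence that loss at scale s is at least g(s/τ), with equality for α = 0. Bounding the
bias amounts to bounding τ.

For the CM-estimate, the objective at (0, 0) is at most c(1 - ε)g(t) + cε + log t for each t ≥ σ,
whereas at a solution with slopes θ it is at least log τ plus the infimum of c(1 - ε)g(u) + log u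
over u ≥ γ. Hence log τ ≤ D whenever D bounds the gap between the two infima
(`IsCMSol.log_resScale_le`). For the S-estimate, a remote point mass lying on a tilted hyperplane
forces a maximum bias of at least √((σ/γ)² - 1) (`le_maxBias_s`). Domination thus reduces to D ≤
log(σ/γ).

For c ≤ 1/φ(s₀) this follows from ε/φ(s₀) < log(σ/γ) (`lt_log_ratio`) and from the fact that c(1 -
ε)g + log is smallest at γ on [γ, σ] (`objective_min`). Both rest on -φ being the derivative of g
with respect to log s: φ is nondecreasing up to s₀, beyond s₀ convexity puts g above its tangent,
and (1 - b)² ≤ 2φ(s₀) balances the two sides. For strictness, c > c₁ makes c(1 - ε)g + log smaller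
at σ_M than anywhere on [γ, σ] for suitable small ε, so D = cε < log(σ/γ) is admissible. -/

lemma IsLoss.apply_abs {ρ : ℝ → ℝ} (h : IsLoss ρ) (u : ℝ) : ρ |u| = ρ u := by
  rcases abs_choice u with hu | hu <;> rw [hu]
  exact h.symm u

lemma IsLoss.le_of_abs_le {ρ : ℝ → ℝ} (h : IsLoss ρ) {u v : ℝ} (huv : |u| ≤ |v|) : ρ u ≤ ρ v := by
  rw [← h.apply_abs u, ← h.apply_abs v]
  exact h.mono (abs_nonneg u) (abs_nonneg v) huv

lemma IsLoss.nonneg {ρ : ℝ → ℝ} (h : IsLoss ρ) (u : ℝ) : 0 ≤ ρ u := by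
  rw [← h.zero]
  exact h.le_of_abs_le (by simp)

lemma IsLoss.le_one {ρ : ℝ → ℝ} (h : IsLoss ρ) (u : ℝ) : ρ u ≤ 1 := by
  refine ge_of_tendsto h.lim ?_
  filter_upwards [eventually_ge_atTop |u|] with v hv
  exact h.le_of_abs_le (hv.trans (le_abs_self v))

lemma IsLoss.measurable {ρ : ℝ → ℝ} (h : IsLoss ρ) : Measurable ρ := by
  have h1 : Monotone fun u : ℝ => ρ (max u 0) := fun u v huv =>
    h.mono (mem_Ici.2 (le_max_right _ _)) (mem_Ici.2 (le_max_right _ _)) (max_le_max huv le_rfl)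
  have h2 : ρ = (fun u : ℝ => ρ (max u 0)) ∘ fun u => |u| := by
    ext u
    simp [h.apply_abs]
  rw [h2]
  exact h1.measurable.comp measurable_abs

lemma IsLoss.div_anti {ρ : ℝ → ℝ} (h : IsLoss ρ) (u : ℝ) {s t : ℝ} (hs : 0 < s) (hst : s ≤ t) :
    ρ (u / t) ≤ ρ (u / s) := by
  apply h.le_of_abs_le
  rw [abs_div, abs_div, abs_of_pos hs, abs_of_pos (hs.trans_le hst)]
  gcongr

lemma IsLoss.integrable_comp {ρ : ℝ → ℝ} (h : IsLoss ρ) {Ω : Type*} [MeasurableSpace Ω]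
    (μ : Measure Ω) [IsFiniteMeasure μ] {f : Ω → ℝ} (hf : Measurable f) :
    Integrable (fun w => ρ (f w)) μ := by
  refine Integrable.of_bound (h.measurable.comp hf).aestronglyMeasurable 1 (ae_of_all _ fun w => ?_)
  rw [Real.norm_of_nonneg (h.nonneg _)]
  exact h.le_one _

lemma IsLoss.tendsto_abs {ρ : ℝ → ℝ} (h : IsLoss ρ) {ι : Type*} {l : Filter ι} {f : ι → ℝ}
    (hf : Tendsto (fun i => |f i|) l atTop) : Tendsto (fun i => ρ (f i)) l (𝓝 1) := by
  refine (h.lim.comp hf).congr fun i => ?_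
  simp [h.apply_abs]

/-! ### The function `g` -/

lemma g_nonneg {ρ : ℝ → ℝ} (h : IsLoss ρ) (s : ℝ) : 0 ≤ g ρ s :=
  integral_nonneg fun _ => h.nonneg _

lemma g_anti {ρ : ℝ → ℝ} (h : IsLoss ρ) : AntitoneOn (g ρ) (Ioi 0) := fun s hs t _ hst =>
  integral_mono (h.integrable_comp _ (by fun_prop)) (h.integrable_comp _ (by fun_prop))
    fun _ => h.div_anti _ hs hst

lemma tendsto_g_zero {ρ : ℝ → ℝ} (h : IsLoss ρ) : Tendsto (g ρ) (𝓝[>] 0) (𝓝 1) := by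
  have h1 : (1 : ℝ) = ∫ _, (1 : ℝ) ∂(gaussianReal 0 1) := by simp
  rw [h1]
  refine tendsto_integral_filter_of_dominated_convergence (fun _ => 1) ?_ ?_ (integrable_const _) ?_
  · exact Eventually.of_forall fun s => (h.measurable.comp (by fun_prop)).aestronglyMeasurable
  · refine Eventually.of_forall fun s => ae_of_all _ fun z => ?_
    rw [Real.norm_of_nonneg (h.nonneg _)]
    exact h.le_one _
  · have : NullSingletonClass (gaussianReal 0 1) := nullSingletonClass_gaussianReal one_ne_zero
    have h0 : ∀ᵐ z ∂(gaussianReal 0 1), z ≠ 0 := by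
      simp [ae_iff]
    filter_upwards [h0] with z hz
    apply h.tendsto_abs
    have h2 : Tendsto (fun s : ℝ => |z| * s⁻¹) (𝓝[>] 0) atTop :=
      tendsto_inv_nhdsGT_zero.const_mul_atTop (abs_pos.2 hz)
    refine h2.congr' ?_
    filter_upwards [self_mem_nhdsWithin] with s hs
    rw [abs_div, abs_of_pos (mem_Ioi.1 hs), div_eq_mul_inv]

lemma exists_lt_g {ρ : ℝ → ℝ} (h : IsLoss ρ) {v : ℝ} (hv : v < 1) :
    ∃ δ > 0, ∀ s, 0 < s → s ≤ δ → v < g ρ s := by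
  obtain ⟨δ, h1, h2⟩ := ((tendsto_g_zero h).eventually (lt_mem_nhds hv) |>.and
    self_mem_nhdsWithin).exists
  exact ⟨δ, h2, fun s hs hsd => h1.trans_le (g_anti h hs h2 hsd)⟩

lemma gaussianReal_Ioo_pos {a b : ℝ} (hab : a < b) : 0 < (gaussianReal 0 1).real (Ioo a b) := by
  rw [measureReal_def, ENNReal.toReal_pos_iff]
  refine ⟨pos_iff_ne_zero.2 fun h0 => ?_, measure_lt_top _ _⟩
  have := gaussianReal_absolutelyContinuous' 0 one_ne_zero h0
  simp [hab.not_ge] at this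

/-- Unless `g` is identically `1`, it eventually falls below any of its values. -/
lemma exists_g_lt {ρ : ℝ → ℝ} (h : IsLoss ρ) {s₀ : ℝ} (hs₀ : 0 < s₀) (hg : g ρ s₀ < 1) {s : ℝ}
    (hs : 0 < s) :
    ∃ t > s, g ρ t < g ρ s := by
  obtain ⟨u, hu0, hu1⟩ : ∃ u > 0, ρ u < 1 := by
    by_contra! hcon
    have h1 : ∀ᵐ z ∂(gaussianReal 0 1), ρ (z / s₀) = 1 := by
      have : NullSingletonClass (gaussianReal 0 1) := nullSingletonClass_gaussianReal one_ne_zero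
      have h0 : ∀ᵐ z ∂(gaussianReal 0 1), z ≠ 0 := by simp [ae_iff]
      filter_upwards [h0] with z hz
      refine le_antisymm (h.le_one _) ?_
      rw [← h.apply_abs]
      exact hcon _ (abs_pos.2 (div_ne_zero hz hs₀.ne'))
    rw [g, integral_congr_ae h1] at hg
    simp at hg
  obtain ⟨v, hv1, hv2⟩ := ((h.lim.eventually (lt_mem_nhds hu1)).and
    (eventually_ge_atTop u)).exists
  have hv0 : 0 < v := hu0.trans_le hv2
  -- The factor 2v/u is chosen so that for z in (sv, 2sv) one has z/s > v but z/(2v/u · s) < u. The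
  -- loss drops by at least ρ v - ρ u > 0 on this interval of positive probability.
  have hk : 1 < 2 * v / u := by
    rw [one_lt_div hu0]; linarith
  have hst : s < 2 * v / u * s := lt_mul_of_one_lt_left hs hk
  refine ⟨2 * v / u * s, hst, ?_⟩
  have key : (gaussianReal 0 1).real (Ioo (s * v) (2 * (s * v))) * (ρ v - ρ u) ≤
      g ρ s - g ρ (2 * v / u * s) := by
    rw [g, g, ← integral_sub (h.integrable_comp _ (by fun_prop)) (h.integrable_comp _ (by fun_prop)),
      ← smul_eq_mul, ← integral_indicator_const _ measurableSet_Ioo]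
    refine integral_mono ((integrable_const _).indicator measurableSet_Ioo)
      ((h.integrable_comp _ (by fun_prop)).sub (h.integrable_comp _ (by fun_prop))) fun z => ?_
    by_cases hz : z ∈ Ioo (s * v) (2 * (s * v))
    · have hz0 : 0 < z := (mul_pos hs hv0).trans hz.1
      simp only [indicator_of_mem hz]
      have h1 : ρ v ≤ ρ (z / s) := by
        apply h.mono hv0.le (div_pos hz0 hs).le
        rw [le_div_iff₀ hs]; linarith [hz.1]
      have h2 : ρ (z / (2 * v / u * s)) ≤ ρ u := by
        apply h.mono (div_pos hz0 (by positivity)).le hu0.le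
        rw [div_le_iff₀ (by positivity)]
        have : u * (2 * v / u * s) = 2 * (s * v) := by field_simp
        rw [this]; exact hz.2.le
      linarith
    · simp only [indicator_of_notMem hz]
      exact sub_nonneg.2 (h.div_anti _ hs hst.le)
  have := mul_pos (gaussianReal_Ioo_pos (a := s * v) (b := 2 * (s * v))
    (by linarith [mul_pos hs hv0])) (sub_pos.2 hv1)
  linarith

/-- A convex function with equal values at two points cannot decrease afterwards, which contradicts
`exists_g_lt`. -/
lemma g_strictAnti {ρ : ℝ → ℝ} (h : IsLoss ρ) (hc : ConvexOn ℝ (Ioi 0) (g ρ)) {s₀ : ℝ}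
    (hs₀ : 0 < s₀) (hg : g ρ s₀ < 1) : StrictAntiOn (g ρ) (Ioi 0) := by
  intro s hs t ht hst
  refine lt_of_le_of_ne (g_anti h hs ht hst.le) fun heq => ?_
  obtain ⟨r, hr, hlt⟩ := exists_g_lt h hs₀ hg ht
  have := hc.slope_mono_adjacent hs (mem_Ioi.2 (lt_trans ht hr)) hst hr
  rw [heq, sub_self, zero_div] at this
  have h2 : 0 ≤ g ρ r - g ρ t := by
    have := mul_nonneg this (sub_pos.2 hr).le
    rwa [div_mul_cancel₀ _ (sub_pos.2 hr).ne', ← heq] at this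
  linarith

/-! ### Residuals under the Gaussian model -/

lemma continuous_resid {p : ℕ} : Continuous fun q : Par p × Obs p => resid q.1 q.2 := by
  unfold resid
  fun_prop

lemma measurable_resid {p : ℕ} (z : Par p) : Measurable (resid z) :=
  (continuous_resid.comp (by fun_prop : Continuous fun w : Obs p => (z, w))).measurable

instance {p : ℕ} : IsProbabilityMeasure (gaussModel p) := by
  unfold gaussModel; infer_instance

/-- The standard deviation of the residuals under the model. -/
def resScale {p : ℕ} (θ : Reg p) : ℝ := √(1 + ‖θ‖ ^ 2)

lemma resScale_sq {p : ℕ} (θ : Reg p) : resScale θ ^ 2 = 1 + ‖θ‖ ^ 2 :=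
  Real.sq_sqrt (by positivity)

lemma one_le_resScale {p : ℕ} (θ : Reg p) : 1 ≤ resScale θ := by
  rw [resScale, Real.one_le_sqrt]
  linarith [sq_nonneg ‖θ‖]

lemma resScale_pos {p : ℕ} (θ : Reg p) : 0 < resScale θ := one_pos.trans_le (one_le_resScale θ)

lemma map_resid_gaussModel {p : ℕ} (z : Par p) :
    (gaussModel p).map (resid z) = (gaussianReal 0 1).map fun x => resScale z.2 * x - z.1 := by
  have h1 : (stdGaussian (Reg p)).map (fun x => -inner ℝ x z.2) =
      gaussianReal 0 (Real.toNNReal (‖z.2‖ ^ 2)) := by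
    have := IsGaussian.map_eq_gaussianReal (μ := stdGaussian (Reg p)) (-(innerSL ℝ z.2))
    rw [variance_dual_stdGaussian, integral_strongDual_stdGaussian, norm_neg, innerSL_apply_norm] at this
    rw [← this]
    congr 1
    ext x
    simp [real_inner_comm]
  have h2 : resid z = (fun q : ℝ × ℝ => q.1 + q.2) ∘
      Prod.map (fun y : ℝ => y - z.1) (fun x : Reg p => -inner ℝ x z.2) := by
    ext w
    simp [resid]; ring
  rw [h2, ← Measure.map_map (by fun_prop) (by fun_prop), gaussModel,
    ← Measure.map_prod_map _ _ (by fun_prop) (by fun_prop), h1, gaussianReal_map_sub_const]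
  change Measure.conv _ _ = _
  rw [gaussianReal_conv_gaussianReal]
  have h3 : (fun x => resScale z.2 * x - z.1) = (fun x => x - z.1) ∘ fun x => resScale z.2 * x := rfl
  rw [h3, ← Measure.map_map (by fun_prop) (by fun_prop), gaussianReal_map_const_mul,
    gaussianReal_map_sub_const]
  congr 1
  · ring
  · ext
    simp [resScale_sq]

lemma expLoss_gaussModel {p : ℕ} {ρ : ℝ → ℝ} (h : IsLoss ρ) (z : Par p) (σ : ℝ) :
    expLoss ρ (gaussModel p) z σ = ∫ x, ρ ((resScale z.2 * x - z.1) / σ) ∂(gaussianReal 0 1) := by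
  have hm : Measurable fun r : ℝ => ρ (r / σ) := h.measurable.comp (by fun_prop)
  rw [expLoss, ← integral_map (φ := resid z) (f := fun r => ρ (r / σ))
    (measurable_resid z).aemeasurable hm.aestronglyMeasurable, map_resid_gaussModel,
    integral_map (by fun_prop) hm.aestronglyMeasurable]

lemma expLoss_gaussModel_of_fst_eq_zero {p : ℕ} {ρ : ℝ → ℝ} (h : IsLoss ρ) (θ : Reg p) (σ : ℝ) :
    expLoss ρ (gaussModel p) (0, θ) σ = g ρ (σ / resScale θ) := by
  rw [expLoss_gaussModel h, g]
  congr 1 with x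
  have := (resScale_pos θ).ne'
  congr 1
  simp only [sub_zero]
  rw [div_div_eq_mul_div, mul_comm]

/-- Shifting a standard normal variable increases its expected loss. -/
lemma integral_loss_le_integral_shift {ρ : ℝ → ℝ} (h : IsLoss ρ) (a : ℝ) :
    ∫ x, ρ x ∂(gaussianReal 0 1) ≤ ∫ x, ρ (x - a) ∂(gaussianReal 0 1) := by
  set f := gaussianPDFReal 0 1 with hf
  have hfi : Integrable f := integrable_gaussianPDFReal 0 1
  set D : ℝ → ℝ := fun x => ρ (x - a) - ρ x with hD
  have hDm : Measurable D := (h.measurable.comp (by fun_prop)).sub h.measurable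
  have hDb : ∀ x, ‖D x‖ ≤ 1 := fun x => by
    rw [Real.norm_eq_abs, abs_le]
    constructor <;> simp only [hD] <;> linarith [h.nonneg x, h.nonneg (x - a), h.le_one x, h.le_one (x - a)]
  have hint : ∀ k : ℝ → ℝ, Integrable k → Integrable fun x => D x * k x := fun k hk =>
    hk.bdd_mul hDm.aestronglyMeasurable (ae_of_all _ hDb)
  have hdiff : ∫ x, ρ (x - a) ∂(gaussianReal 0 1) - ∫ x, ρ x ∂(gaussianReal 0 1) =
      ∫ x, D x * f x := by
    rw [← integral_sub (h.integrable_comp _ (by fun_prop)) (h.integrable_comp _ (by fun_prop)),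
      integral_gaussianReal_eq_integral_smul one_ne_zero]
    exact integral_congr_ae (ae_of_all _ fun x => by simp [hD, hf, mul_comm])
  -- The reflection x ↦ a - x changes the sign of D. Twice the integral is therefore that of
  -- D(x)(f(x) - f(a - x)), and both factors have the sign of |a - x| - |x|.
  have hrefl : ∫ x, D x * f x = -∫ x, D x * f (a - x) := by
    rw [← integral_sub_left_eq_self (fun x => D x * f x) volume a, ← integral_neg]
    refine integral_congr_ae (ae_of_all _ fun x => ?_)
    have h1 : ρ (a - x - a) = ρ x := by rw [← h.symm]; congr 1; ring
    have h2 : ρ (a - x) = ρ (x - a) := by rw [← h.symm]; congr 1; ring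
    simp only [hD, h1, h2]
    ring
  have hsum : 0 ≤ ∫ x, D x * f x - D x * f (a - x) := by
    refine integral_nonneg fun x => ?_
    have hfmono : ∀ u v : ℝ, |u| ≤ |v| → f v ≤ f u := fun u v huv => by
      simp only [hf, gaussianPDFReal, sub_zero, NNReal.coe_one, mul_one]
      refine mul_le_mul_of_nonneg_left (Real.exp_le_exp.2 ?_) (by positivity)
      linarith [sq_le_sq.2 huv]
    simp only [Pi.zero_apply, ← mul_sub, hD]
    rcases le_total |x| |a - x| with hx | hx
    · have h1 : ρ x ≤ ρ (x - a) := h.le_of_abs_le (by rwa [abs_sub_comm x a])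
      exact mul_nonneg (sub_nonneg.2 h1) (sub_nonneg.2 (hfmono _ _ hx))
    · have h1 : ρ (x - a) ≤ ρ x := h.le_of_abs_le (by rwa [abs_sub_comm x a])
      exact mul_nonneg_of_nonpos_of_nonpos (sub_nonpos.2 h1) (sub_nonpos.2 (hfmono _ _ hx))
  rw [integral_sub (hint _ hfi) (hint _ (hfi.comp_sub_left a))] at hsum
  linarith

lemma IsLoss.comp_mul {ρ : ℝ → ℝ} (h : IsLoss ρ) {k : ℝ} (hk : 0 < k) :
    IsLoss fun u => ρ (k * u) where
  symm u := by rw [mul_neg, h.symm]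
  mono u hu v hv huv := h.mono (mul_nonneg hk.le hu) (mul_nonneg hk.le hv) (by gcongr)
  zero := by rw [mul_zero, h.zero]
  lim := h.lim.comp (tendsto_id.const_mul_atTop hk)
  finite_disc := by
    refine (h.finite_disc.preimage (f := fun u => k * u) (mul_right_injective₀ hk.ne').injOn).subset
      fun u hu => ?_
    exact fun hc => hu (ContinuousAt.comp (f := fun u => k * u) hc (by fun_prop))

/-- The intercept is a shift of the normal residual, so dropping it can only lower the expected
loss. All later lower bounds see the parameter only through `resScale`. -/
lemma g_le_expLoss_gaussModel {p : ℕ} {ρ : ℝ → ℝ} (h : IsLoss ρ) (z : Par p) {σ : ℝ} (hσ : 0 < σ) :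
    g ρ (σ / resScale z.2) ≤ expLoss ρ (gaussModel p) z σ := by
  have hτ := resScale_pos z.2
  have := integral_loss_le_integral_shift (h.comp_mul (div_pos hτ hσ)) (z.1 / resScale z.2)
  rw [expLoss_gaussModel h, g]
  convert this using 4 with x x
  · field_simp
  · field_simp

/-- Since g tends to 1 at 0, a loss below 1 keeps σ/τ away from 0 and thus bounds the slopes. Once τ
≤ T, the residual is at least |α| - T|x| in absolute value, and the loss of this tends to 1 as |α|
grows, which bounds the intercept. -/
lemma expLoss_coercive {ρ : ℝ → ℝ} (h : IsLoss ρ) (p : ℕ) {v S : ℝ} (hv : v < 1) (hS : 0 < S) :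
    ∃ K, ∀ (z : Par p) (σ : ℝ), 0 < σ → σ ≤ S → expLoss ρ (gaussModel p) z σ ≤ v → ‖z‖ ≤ K := by
  obtain ⟨δ, hδ, hδg⟩ := exists_lt_g h hv
  set T := S / δ with hT
  have hT0 : 0 < T := div_pos hS hδ
  have h1 : Tendsto (fun A : ℝ => ∫ x, ρ (max (A - T * |x|) 0 / S) ∂(gaussianReal 0 1)) atTop
      (𝓝 1) := by
    have h1 : (1 : ℝ) = ∫ _, (1 : ℝ) ∂(gaussianReal 0 1) := by simp
    rw [h1]
    refine tendsto_integral_filter_of_dominated_convergence (fun _ => 1) ?_ ?_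
      (integrable_const _) ?_
    · exact Eventually.of_forall fun s => (h.measurable.comp (by fun_prop)).aestronglyMeasurable
    · refine Eventually.of_forall fun s => ae_of_all _ fun z => ?_
      rw [Real.norm_of_nonneg (h.nonneg _)]
      exact h.le_one _
    · refine ae_of_all _ fun z => h.lim.comp (Tendsto.atTop_div_const hS ?_)
      refine tendsto_atTop_mono (fun A => le_max_left _ _) ?_
      exact tendsto_atTop_add_const_right _ _ tendsto_id
  obtain ⟨A, hA⟩ := eventually_atTop.1 (h1.eventually (lt_mem_nhds hv))
  refine ⟨max A T, fun z σ hσ hσS hz => ?_⟩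
  have hτ := resScale_pos z.2
  have hτT : resScale z.2 ≤ T := by
    rw [hT, le_div_iff₀ hδ, mul_comm, ← le_div_iff₀ hτ]
    by_contra! hcon
    have h2 := hδg _ (div_pos hS hτ) hcon.le
    have h3 := g_anti h (mem_Ioi.2 (div_pos hσ hτ)) (mem_Ioi.2 (div_pos hS hτ))
      (by gcongr)
    linarith [g_le_expLoss_gaussModel h z hσ]
  refine max_le ?_ ?_
  · refine le_trans ?_ (le_max_left _ _)
    by_contra! hcon
    have h2 := hA _ hcon.le
    refine absurd (h2.trans_le ?_) (not_lt.2 hz)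
    rw [expLoss_gaussModel h]
    refine integral_mono (h.integrable_comp _ (by fun_prop)) (h.integrable_comp _ (by fun_prop))
      fun x => h.le_of_abs_le ?_
    rw [abs_div, abs_div, abs_of_pos hS, abs_of_pos hσ, abs_of_nonneg (le_max_right _ _)]
    refine div_le_div₀ (abs_nonneg _) (max_le ?_ (abs_nonneg _)) hσ hσS
    have h3 : |resScale z.2 * x| ≤ T * |x| := by
      rw [abs_mul, abs_of_pos hτ]; gcongr
    have h4 := abs_sub_abs_le_abs_sub z.1 (resScale z.2 * x)
    rw [abs_sub_comm] at h4
    rw [Real.norm_eq_abs]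
    linarith
  · refine le_trans ?_ (hτT.trans (le_max_right _ _))
    exact Real.le_sqrt_of_sq_le (by linarith)


/-! ### Expected losses under contamination -/

lemma expLoss_anti {p : ℕ} {ρ : ℝ → ℝ} (h : IsLoss ρ) (H : Measure (Obs p)) [IsFiniteMeasure H]
    (z : Par p) {s t : ℝ} (hs : 0 < s) (hst : s ≤ t) : expLoss ρ H z t ≤ expLoss ρ H z s :=
  integral_mono (h.integrable_comp _ ((measurable_resid z).div_const _))
    (h.integrable_comp _ ((measurable_resid z).div_const _)) fun _ => h.div_anti _ hs hst

lemma expLoss_nonneg {p : ℕ} {ρ : ℝ → ℝ} (h : IsLoss ρ) (H : Measure (Obs p))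
    (z : Par p) (s : ℝ) : 0 ≤ expLoss ρ H z s := integral_nonneg fun _ => h.nonneg _

lemma expLoss_le_one {p : ℕ} {ρ : ℝ → ℝ} (h : IsLoss ρ) (H : Measure (Obs p))
    [IsProbabilityMeasure H] (z : Par p) (s : ℝ) : expLoss ρ H z s ≤ 1 := by
  calc expLoss ρ H z s ≤ ∫ _, (1 : ℝ) ∂H :=
        integral_mono (h.integrable_comp _ ((measurable_resid z).div_const _))
          (integrable_const _) fun _ => h.le_one _
    _ = 1 := by simp

/-- The contaminated distribution `(1 - ε) H₀ + ε H*`. -/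
def contam {p : ℕ} (ε : ℝ) (Hs : Measure (Obs p)) : Measure (Obs p) :=
  ENNReal.ofReal (1 - ε) • gaussModel p + ENNReal.ofReal ε • Hs

lemma isProbabilityMeasure_contam {p : ℕ} {ε : ℝ} (h0 : 0 ≤ ε) (h1 : ε ≤ 1)
    (Hs : Measure (Obs p)) [IsProbabilityMeasure Hs] : IsProbabilityMeasure (contam ε Hs) where
  measure_univ := by
    simp only [contam, Measure.coe_add, Measure.coe_smul, Pi.add_apply, Pi.smul_apply, measure_univ,
      smul_eq_mul, mul_one]
    rw [← ENNReal.ofReal_add (by linarith) h0]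
    simp

lemma expLoss_contam {p : ℕ} {ρ : ℝ → ℝ} (h : IsLoss ρ) {ε : ℝ} (h0 : 0 ≤ ε) (h1 : ε ≤ 1)
    (Hs : Measure (Obs p)) [IsProbabilityMeasure Hs] (z : Par p) (s : ℝ) :
    expLoss ρ (contam ε Hs) z s = (1 - ε) * expLoss ρ (gaussModel p) z s + ε * expLoss ρ Hs z s := by
  have hm : Measurable fun w => resid z w / s := (measurable_resid z).div_const _
  rw [expLoss, contam, integral_add_measure ((h.integrable_comp _ hm).smul_measure (by simp))
    ((h.integrable_comp _ hm).smul_measure (by simp)), integral_smul_measure, integral_smul_measure,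
    ENNReal.toReal_ofReal (by linarith), ENNReal.toReal_ofReal h0]
  rfl

lemma le_expLoss_contam {p : ℕ} {ρ : ℝ → ℝ} (h : IsLoss ρ) {ε : ℝ} (h0 : 0 ≤ ε) (h1 : ε ≤ 1)
    (Hs : Measure (Obs p)) [IsProbabilityMeasure Hs] (z : Par p) (s : ℝ) :
    (1 - ε) * expLoss ρ (gaussModel p) z s ≤ expLoss ρ (contam ε Hs) z s := by
  rw [expLoss_contam h h0 h1]
  linarith [mul_nonneg h0 (expLoss_nonneg h Hs z s)]

lemma expLoss_contam_le {p : ℕ} {ρ : ℝ → ℝ} (h : IsLoss ρ) {ε : ℝ} (h0 : 0 ≤ ε) (h1 : ε ≤ 1)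
    (Hs : Measure (Obs p)) [IsProbabilityMeasure Hs] (z : Par p) (s : ℝ) :
    expLoss ρ (contam ε Hs) z s ≤ (1 - ε) * expLoss ρ (gaussModel p) z s + ε := by
  rw [expLoss_contam h h0 h1]
  linarith [mul_le_mul_of_nonneg_left (expLoss_le_one h Hs z s) h0]

lemma expLoss_gaussModel_zero {p : ℕ} {ρ : ℝ → ℝ} (h : IsLoss ρ) (s : ℝ) :
    expLoss ρ (gaussModel p) 0 s = g ρ s := by
  have := expLoss_gaussModel_of_fst_eq_zero h (0 : Reg p) s
  rw [show resScale (0 : Reg p) = 1 by simp [resScale], div_one] at this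
  exact this

/-! ### Existence of CM-estimates -/

/-- Semicontinuity of the expected loss, at the cost of an arbitrarily small increase of the scale. -/
lemma expLoss_le_of_tendsto {p : ℕ} {ρ : ℝ → ℝ} (h : IsLoss ρ) (H : Measure (Obs p))
    [IsFiniteMeasure H] {zs : ℕ → Par p} {ss : ℕ → ℝ} {z : Par p} {s t e : ℝ}
    (hz : Tendsto zs atTop (𝓝 z)) (hs : Tendsto ss atTop (𝓝 s)) (hs0 : 0 < s) (hst : s < t)
    (he : Tendsto (fun n => expLoss ρ H (zs n) (ss n)) atTop (𝓝 e)) : expLoss ρ H z t ≤ e := by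
  have hm : ∀ z t, Measurable fun w : Obs p => resid z w / t :=
    fun z t => (measurable_resid z).div_const _
  -- As ρ may jump, the integrands need not converge. Capping them at the target value restores
  -- convergence: t > s makes |r/t| < |r/s| strictly when r ≠ 0, so the cap is eventually active.
  have hlim : Tendsto (fun n => ∫ w, min (ρ (resid z w / t)) (ρ (resid (zs n) w / ss n)) ∂H) atTop
      (𝓝 (expLoss ρ H z t)) := by
    refine tendsto_integral_of_dominated_convergence (fun _ => 1) (fun n => ?_)
      (integrable_const _) (fun n => ae_of_all _ fun w => ?_) (ae_of_all _ fun w => ?_)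
    · exact ((h.measurable.comp (hm _ _)).min (h.measurable.comp (hm _ _))).aestronglyMeasurable
    · rw [Real.norm_of_nonneg (le_min (h.nonneg _) (h.nonneg _))]
      exact (min_le_left _ _).trans (h.le_one _)
    · refine tendsto_const_nhds.congr' ?_
      have hev : ∀ᶠ n in atTop, ρ (resid z w / t) ≤ ρ (resid (zs n) w / ss n) := by
        by_cases hr : resid z w = 0
        · exact Eventually.of_forall fun n => by rw [hr, zero_div, h.zero]; exact h.nonneg _
        · have h1 : Tendsto (fun n => |resid (zs n) w / ss n|) atTop (𝓝 |resid z w / s|) := by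
            refine (Tendsto.div ?_ hs hs0.ne').abs
            exact ((continuous_resid.comp (by fun_prop : Continuous fun z : Par p => (z, w))).tendsto
              z).comp hz
          have h2 : |resid z w / t| < |resid z w / s| := by
            rw [abs_div, abs_div, abs_of_pos hs0, abs_of_pos (hs0.trans hst)]
            exact div_lt_div_of_pos_left (abs_pos.2 hr) hs0 hst
          filter_upwards [h1.eventually (lt_mem_nhds h2)] with n hn
          exact h.le_of_abs_le hn.le
      filter_upwards [hev] with n hn
      rw [min_eq_left hn]
  refine le_of_tendsto_of_tendsto' hlim he fun n => ?_
  exact integral_mono ((h.integrable_comp _ (hm _ _)).inf (h.integrable_comp _ (hm _ _)))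
    (h.integrable_comp _ (hm _ _)) fun w => min_le_right _ _

/-- Direct method: a minimizing sequence stays in a compact set and has a limit (z, σ). The loss may
jump at σ itself, but the objective is an infimum over scales, so scales t slightly above σ suffice
to attain the infimum at z. -/
lemma exists_isCMSol {p : ℕ} {ρ : ℝ → ℝ} (h : IsLoss ρ) {b c : ℝ} (hc : 0 < c)
    (H : Measure (Obs p)) [IsProbabilityMeasure H]
    (hcoer : ∀ S > 0, ∃ K, ∀ (z : Par p) (σ : ℝ), 0 < σ → σ ≤ S → expLoss ρ H z σ ≤ b → ‖z‖ ≤ K)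
    {δ : ℝ} (hδ : 0 < δ) (hlow : ∀ z, ∀ σ ∈ feasible ρ b H z, δ ≤ σ)
    (hne : ∃ z, (feasible ρ b H z).Nonempty) : ∃ z, IsCMSol ρ b c H z := by
  set X : Set (Par p × ℝ) := {q | q.2 ∈ feasible ρ b H q.1} with hX
  set J : Par p × ℝ → ℝ := fun q => c * expLoss ρ H q.1 q.2 + Real.log q.2 with hJ
  have hXne : (J '' X).Nonempty := by
    obtain ⟨z, σ, hσ⟩ := hne
    exact ⟨_, (z, σ), hσ, rfl⟩
  have hlogJ : ∀ q, Real.log q.2 ≤ J q := fun q =>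
    le_add_of_nonneg_left (mul_nonneg hc.le (expLoss_nonneg h H _ _))
  have hbdd : BddBelow (J '' X) := by
    refine ⟨Real.log δ, ?_⟩
    rintro _ ⟨q, hq, rfl⟩
    exact (Real.log_le_log hδ (hlow _ _ hq)).trans (hlogJ q)
  set m := sInf (J '' X) with hm
  obtain ⟨u, hu, hum, huX⟩ := exists_seq_tendsto_sInf hXne hbdd
  choose q hqX hqu using huX
  obtain ⟨K, hK⟩ := hcoer (Real.exp (u 0)) (Real.exp_pos _)
  have hS : ∀ n, (q n).2 ≤ Real.exp (u 0) := fun n => by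
    rw [← Real.log_le_iff_le_exp (hqX n).1]
    exact (hlogJ _).trans ((hqu n).le.trans (hu (Nat.zero_le n)))
  have hcomp : IsCompact (Metric.closedBall (0 : Par p) K ×ˢ Icc δ (Real.exp (u 0))) :=
    (isCompact_closedBall _ _).prod isCompact_Icc
  obtain ⟨⟨z, σ⟩, hzσ, φ, hφ, hlim⟩ := hcomp.tendsto_subseq (x := q) fun n =>
    ⟨by simpa using hK _ _ (hqX n).1 (hS n) (hqX n).2, hlow _ _ (hqX n), hS n⟩
  have hσ : 0 < σ := hδ.trans_le hzσ.2.1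
  have hlim1 : Tendsto (fun n => (q (φ n)).1) atTop (𝓝 z) := (continuous_fst.tendsto _).comp hlim
  have hlim2 : Tendsto (fun n => (q (φ n)).2) atTop (𝓝 σ) := (continuous_snd.tendsto _).comp hlim
  -- The limit of the expected losses exists because the objective and log σ both converge.
  have hlimE : Tendsto (fun n => expLoss ρ H (q (φ n)).1 (q (φ n)).2) atTop
      (𝓝 ((m - Real.log σ) / c)) := by
    refine (((hum.comp hφ.tendsto_atTop).sub (hlim2.log hσ.ne')).div_const c).congr fun n => ?_
    simp only [Function.comp, ← hqu, hJ]
    field_simp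
    ring
  have hb : (m - Real.log σ) / c ≤ b := le_of_tendsto' hlimE fun n => (hqX _).2
  have hmle : ∀ z', (m : EReal) ≤ cmObj ρ b c H z' := fun z' => le_iInf₂ fun s hs =>
    EReal.coe_le_coe_iff.2 (csInf_le hbdd ⟨(z', s), hs, rfl⟩)
  have hle : cmObj ρ b c H z ≤ m := by
    have h1 : Tendsto (fun t : ℝ => ((m - Real.log σ + Real.log t : ℝ) : EReal)) (𝓝[>] σ)
        (𝓝 (m : EReal)) := by
      refine (continuous_coe_real_ereal.tendsto _).comp ?_
      have : Tendsto (fun t : ℝ => m - Real.log σ + Real.log t) (𝓝 σ)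
          (𝓝 (m - Real.log σ + Real.log σ)) :=
        tendsto_const_nhds.add (Real.continuousAt_log hσ.ne')
      rw [sub_add_cancel] at this
      exact this.mono_left nhdsWithin_le_nhds
    refine ge_of_tendsto h1 ?_
    filter_upwards [self_mem_nhdsWithin] with t ht
    have h2 := expLoss_le_of_tendsto h H hlim1 hlim2 hσ ht hlimE
    refine (iInf₂_le t ⟨hσ.trans ht, h2.trans hb⟩).trans (EReal.coe_le_coe_iff.2 ?_)
    rw [le_div_iff₀ hc] at h2
    linarith
  refine ⟨z, ?_, ?_, fun z' => hle.trans (hmle z')⟩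
  · exact ((EReal.bot_lt_coe m).trans_le (hmle z)).ne'
  · exact (hle.trans_lt (EReal.coe_lt_top m)).ne

lemma exists_isCMSol_contam {p : ℕ} {ρ : ℝ → ℝ} (h : IsLoss ρ) {b c ε s : ℝ} (hc : 0 < c)
    (h0 : 0 ≤ ε) (hε : ε < 1 - b) (hb : 0 < b) (hs : 0 < s) (hsb : (1 - ε) * g ρ s + ε ≤ b)
    (Hs : Measure (Obs p)) [IsProbabilityMeasure Hs] : ∃ z, IsCMSol ρ b c (contam ε Hs) z := by
  have h1 : ε ≤ 1 := by linarith
  have hpos : 0 < 1 - ε := by linarith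
  have := isProbabilityMeasure_contam h0 h1 Hs
  have hv : b / (1 - ε) < 1 := by rw [div_lt_one hpos]; linarith
  have hfe : ∀ (z : Par p) σ, expLoss ρ (contam ε Hs) z σ ≤ b →
      expLoss ρ (gaussModel p) z σ ≤ b / (1 - ε) := fun z σ hz => by
    rw [le_div_iff₀ hpos, mul_comm]
    exact (le_expLoss_contam h h0 h1 Hs z σ).trans hz
  obtain ⟨δ, hδ, hδg⟩ := exists_lt_g h hv
  refine exists_isCMSol h hc _ (fun S hS => ?_) hδ (fun z σ hσ => ?_) ⟨0, s, hs, ?_⟩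
  · obtain ⟨K, hK⟩ := expLoss_coercive h p hv hS
    exact ⟨K, fun z σ h2 h3 h4 => hK z σ h2 h3 (hfe z σ h4)⟩
  · by_contra! hcon
    have h2 := hδg (σ / resScale z.2) (div_pos hσ.1 (resScale_pos _))
      ((div_le_self hσ.1.le (one_le_resScale _)).trans hcon.le)
    linarith [g_le_expLoss_gaussModel h z hσ.1, hfe z σ hσ.2]
  · refine (expLoss_contam_le h h0 h1 Hs 0 s).trans ?_
    rwa [expLoss_gaussModel_zero h]

/-! ### An upper bound for the bias of CM-estimates -/

/-- The core of the upper bound. The solution is compared with (0, 0), charging all contaminated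
mass the full loss 1 at (0, 0) and loss 0 at the solution; rescaling by τ then contributes exactly
log τ. `hD` asks that each scale u allowed at the solution be matched by a scale t allowed at (0, 0)
at extra cost at most D. -/
lemma IsCMSol.log_resScale_le {p : ℕ} {ρ : ℝ → ℝ} (h : IsLoss ρ) {b c ε r s D : ℝ} (hc : 0 < c)
    (h0 : 0 ≤ ε) (h1 : ε < 1) (hanti : StrictAntiOn (g ρ) (Ioi 0)) (hr : 0 < r)
    (hrb : (1 - ε) * g ρ r = b) (hs : 0 < s) (hsb : (1 - ε) * g ρ s + ε = b)
    (hD : ∀ u ≥ r, ∃ t ≥ s, c * ε + (c * (1 - ε) * g ρ t + Real.log t) ≤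
      c * (1 - ε) * g ρ u + Real.log u + D)
    (Hs : Measure (Obs p)) [IsProbabilityMeasure Hs] {z : Par p}
    (hz : IsCMSol ρ b c (contam ε Hs) z) : Real.log (resScale z.2) ≤ D := by
  have hpos : 0 < 1 - ε := by linarith
  have hτ := resScale_pos z.2
  obtain ⟨hbot, htop, hmin⟩ := hz
  obtain ⟨m, hm⟩ : ∃ m : ℝ, cmObj ρ b c (contam ε Hs) z = m :=
    ⟨_, (EReal.coe_toReal htop hbot).symm⟩
  have hupper : ∀ t ≥ s, m ≤ c * ε + (c * (1 - ε) * g ρ t + Real.log t) := fun t ht => by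
    have ht0 : 0 < t := hs.trans_le ht
    have h2 := expLoss_contam_le h h0 h1.le Hs 0 t
    rw [expLoss_gaussModel_zero h] at h2
    have h3 : (1 - ε) * g ρ t ≤ (1 - ε) * g ρ s :=
      mul_le_mul_of_nonneg_left (g_anti h hs ht0 ht) hpos.le
    have h4 : cmObj ρ b c (contam ε Hs) 0 ≤
        ((c * expLoss ρ (contam ε Hs) 0 t + Real.log t : ℝ) : EReal) :=
      iInf₂_le t ⟨ht0, by linarith⟩
    have h5 := (hmin 0).trans h4
    rw [hm, EReal.coe_le_coe_iff] at h5
    have := mul_le_mul_of_nonneg_left h2 hc.le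
    linarith
  have hlower : ((m + Real.log (resScale z.2) - D : ℝ) : EReal) ≤ cmObj ρ b c (contam ε Hs) z := by
    refine le_iInf₂ fun σ hσ => EReal.coe_le_coe_iff.2 ?_
    have h2 : (1 - ε) * g ρ (σ / resScale z.2) ≤ expLoss ρ (contam ε Hs) z σ :=
      (mul_le_mul_of_nonneg_left (g_le_expLoss_gaussModel h z hσ.1) hpos.le).trans
        (le_expLoss_contam h h0 h1.le Hs z σ)
    have hστ := div_pos hσ.1 hτ
    have h3 : r ≤ σ / resScale z.2 := by
      rw [← hanti.le_iff_ge hστ hr]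
      exact le_of_mul_le_mul_left (h2.trans (hσ.2.trans hrb.ge)) hpos
    obtain ⟨t, ht, ht2⟩ := hD _ h3
    have h4 := hupper t ht
    rw [Real.log_div hσ.1.ne' hτ.ne'] at ht2
    have := mul_le_mul_of_nonneg_left h2 hc.le
    linarith
  rw [hm, EReal.coe_le_coe_iff] at hlower
  linarith

lemma maxBias_cm_le {p : ℕ} {ρ : ℝ → ℝ} (h : IsLoss ρ) {b c ε r s D : ℝ} (hc : 0 < c) (hb : 0 < b)
    (h0 : 0 ≤ ε) (h1 : ε < 1 - b) (hanti : StrictAntiOn (g ρ) (Ioi 0)) (hr : 0 < r)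
    (hrb : (1 - ε) * g ρ r = b) (hs : 0 < s) (hsb : (1 - ε) * g ρ s + ε = b)
    (hD : ∀ u ≥ r, ∃ t ≥ s, c * ε + (c * (1 - ε) * g ρ t + Real.log t) ≤
      c * (1 - ε) * g ρ u + Real.log u + D)
    {T : Functional p} (hT : IsCMFunctional ρ b c T) :
    maxBias T ε ≤ ENNReal.ofReal √(Real.exp D ^ 2 - 1) := by
  refine iSup₂_le ?_
  rintro H ⟨Hs, hHs, rfl⟩
  change bias T (contam ε Hs) ≤ _
  have hprob := isProbabilityMeasure_contam h0 (by linarith) Hs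
  obtain ⟨hsome, hnone⟩ := hT (contam ε Hs) hprob
  unfold bias
  cases hz : T (contam ε Hs) with
  | none =>
    obtain ⟨z, hsol⟩ := exists_isCMSol_contam h hc h0 h1 hb hs hsb.le Hs
    exact absurd hsol (hnone hz z)
  | some z =>
    refine ENNReal.ofReal_le_ofReal (Real.le_sqrt_of_sq_le ?_)
    have h2 := (hsome z hz).log_resScale_le h hc h0 (by linarith) hanti hr hrb hs hsb hD
    rw [Real.log_le_iff_le_exp (resScale_pos _)] at h2
    have h3 := pow_le_pow_left₀ (resScale_pos z.2).le h2 2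
    rw [resScale_sq] at h3
    linarith

/-! ### A lower bound for the bias of S-estimates -/

lemma expLoss_dirac {p : ℕ} (ρ : ℝ → ℝ) (w : Obs p) (z : Par p) (s : ℝ) :
    expLoss ρ (Measure.dirac w) z s = ρ (resid z w / s) := by
  simp [expLoss]

/-- Contamination by a point mass at the origin is fitted exactly by zero parameters. With ε ≥ 1 - b
every scale is then feasible, the minimal scale is 0, and no S-solution exists. -/
lemma maxBias_s_eq_top {p : ℕ} {ρ : ℝ → ℝ} (h : IsLoss ρ) {b ε : ℝ} (h0 : 0 ≤ ε) (h1 : ε ≤ 1)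
    (hε : 1 - b ≤ ε) {T : Functional p} (hT : IsSFunctional ρ b T) : maxBias T ε = ⊤ := by
  have hprob := isProbabilityMeasure_contam h0 h1 (Measure.dirac (0 : Obs p))
  have hobj : sObj ρ b (contam ε (Measure.dirac (0 : Obs p))) 0 = 0 := by
    refine le_antisymm (ENNReal.le_of_forall_pos_le_add fun r hr _ => ?_) zero_le
    rw [zero_add, ← ENNReal.ofReal_coe_nnreal]
    refine iInf₂_le (r : ℝ) ⟨by exact_mod_cast hr, ?_⟩
    rw [expLoss_contam h h0 h1, expLoss_dirac]
    have h2 : resid (0 : Par p) 0 = 0 := by simp [resid]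
    rw [h2, zero_div, h.zero]
    have := mul_le_mul_of_nonneg_left (expLoss_le_one h (gaussModel p) 0 r) (sub_nonneg.2 h1)
    linarith
  have hbias : bias T (contam ε (Measure.dirac (0 : Obs p))) = ⊤ := by
    unfold bias
    cases hz : T (contam ε (Measure.dirac (0 : Obs p))) with
    | none => rfl
    | some z =>
      obtain ⟨hne, -, hmin⟩ := (hT _ hprob).1 z hz
      exact absurd (le_antisymm ((hmin 0).trans hobj.le) zero_le) hne
  rw [← top_le_iff, ← hbias]
  exact le_iSup₂ (f := fun H (_ : H ∈ contNbhd p ε) => bias T H) _ ⟨_, inferInstance, rfl⟩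

/-- A point mass at w = (lt, l e) is fitted exactly by the slope t e, whose scale is at most √(1 +
t²) r < s. A slope of norm at most t' < t leaves a residual of order l(t - t') at w, which costs
nearly the full ε and pushes the scale to at least s. -/
lemma le_maxBias_s {p : ℕ} (hp : 0 < p) {ρ : ℝ → ℝ} (h : IsLoss ρ) {b ε r s t : ℝ}
    (h0 : 0 < ε) (h1 : ε < 1 - b) (hb : 0 < b) (hr : 0 < r)
    (hrb : (1 - ε) * g ρ r = b) (hs : √(1 + t ^ 2) * r < s) (hsb : b < (1 - ε) * g ρ s + ε)
    (ht : 0 ≤ t) {T : Functional p} (hT : IsSFunctional ρ b T) :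
    ENNReal.ofReal t ≤ maxBias T ε := by
  have hpos : 0 < 1 - ε := by linarith
  have hε1 : ε ≤ 1 := by linarith
  refine le_of_forall_lt fun a ha => ?_
  obtain ⟨t', ht'0, ha', ht't⟩ : ∃ t' : ℝ, 0 ≤ t' ∧ a < ENNReal.ofReal t' ∧ t' < t := by
    obtain ⟨a', h2, h3⟩ := exists_between ha
    have ha't : a' ≠ ⊤ := h3.ne_top
    refine ⟨a'.toReal, ENNReal.toReal_nonneg, by rwa [ENNReal.ofReal_toReal ha't], ?_⟩
    by_contra! hcon
    exact absurd h3 (not_lt.2 (by rw [← ENNReal.ofReal_toReal ha't]; exact ENNReal.ofReal_le_ofReal hcon))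
  have hs0 : 0 < s := (mul_nonneg (Real.sqrt_nonneg _) hr.le).trans_lt hs
  -- K bounds every parameter whose scale is below s, whatever the contamination. It can therefore
  -- be fixed before the position l of the point mass is chosen.
  obtain ⟨K, hK⟩ := expLoss_coercive h p (v := b / (1 - ε)) (by rw [div_lt_one hpos]; linarith) hs0
  set e : Reg p := EuclideanSpace.single ⟨0, hp⟩ 1 with he
  have hen : ‖e‖ = 1 := by simp [he]
  obtain ⟨l, hl0, hlK, hl⟩ : ∃ l : ℝ, 0 ≤ l ∧ 0 ≤ l * (t - t') - K ∧
      b < (1 - ε) * g ρ s + ε * ρ ((l * (t - t') - K) / s) := by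
    have h1 : Tendsto (fun l : ℝ => l * (t - t') - K) atTop atTop :=
      tendsto_atTop_add_const_right _ (-K) (tendsto_id.atTop_mul_const (sub_pos.2 ht't))
    have h2 := h1.atTop_div_const hs0
    have h3 : Tendsto (fun l : ℝ => (1 - ε) * g ρ s + ε * ρ ((l * (t - t') - K) / s)) atTop
        (𝓝 ((1 - ε) * g ρ s + ε * 1)) := ((h.lim.comp h2).const_mul ε).const_add _
    rw [mul_one] at h3
    obtain ⟨l, h4, h5, h6⟩ := ((h3.eventually (lt_mem_nhds hsb)).and
      ((eventually_ge_atTop 0).and (h1.eventually_ge_atTop 0))).exists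
    exact ⟨l, h5, h6, h4⟩
  set w : Obs p := (l * t, l • e) with hw
  have hprob := isProbabilityMeasure_contam h0.le hε1 (Measure.dirac w)
  have hfar : ∀ z, IsSSol ρ b (contam ε (Measure.dirac w)) z → t' < ‖z.2‖ := by
    rintro z ⟨-, -, hmin⟩
    by_contra! hzt
    have hte : resScale (t • e) = √(1 + t ^ 2) := by
      rw [resScale, norm_smul, hen, mul_one, Real.norm_of_nonneg ht]
    have hτ := resScale_pos (t • e)
    have hfit : sObj ρ b (contam ε (Measure.dirac w)) (0, t • e) ≤
        ENNReal.ofReal (√(1 + t ^ 2) * r) := by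
      rw [← hte]
      refine iInf₂_le _ ⟨mul_pos hτ hr, ?_⟩
      rw [expLoss_contam h h0.le hε1, expLoss_dirac, expLoss_gaussModel_of_fst_eq_zero h,
        mul_div_cancel_left₀ _ hτ.ne', hrb]
      have : resid (0, t • e) w = 0 := by
        simp [resid, hw, inner_smul_left, inner_smul_right, hen, mul_comm]
      rw [this, zero_div, h.zero]
      simp
    have hlt : sObj ρ b (contam ε (Measure.dirac w)) z < ENNReal.ofReal s :=
      ((hmin _).trans hfit).trans_lt ((ENNReal.ofReal_lt_ofReal_iff hs0).2 hs)
    obtain ⟨σ, hσ⟩ := iInf_lt_iff.1 hlt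
    obtain ⟨⟨hσ0, hσb⟩, hσs⟩ := iInf_lt_iff.1 hσ
    rw [ENNReal.ofReal_lt_ofReal_iff hs0] at hσs
    have hle := (expLoss_anti h (contam ε (Measure.dirac w)) z hσ0 hσs.le).trans hσb
    have hz : ‖z‖ ≤ K := by
      refine hK z s hs0 le_rfl ?_
      rw [le_div_iff₀ hpos, mul_comm]
      exact (le_expLoss_contam h h0.le hε1 _ z s).trans hle
    rw [expLoss_contam h h0.le hε1, expLoss_dirac] at hle
    have h2 : g ρ s ≤ expLoss ρ (gaussModel p) z s :=
      (g_anti h (mem_Ioi.2 (div_pos hs0 (resScale_pos z.2))) hs0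
        (div_le_self hs0.le (one_le_resScale _))).trans (g_le_expLoss_gaussModel h z hs0)
    have h3 : ρ ((l * (t - t') - K) / s) ≤ ρ (resid z w / s) := by
      apply h.le_of_abs_le
      rw [abs_div, abs_div, abs_of_nonneg hlK]
      have h5 : inner ℝ e z.2 ≤ t' := (real_inner_le_norm _ _).trans (by rw [hen, one_mul]; exact hzt)
      have h6 : |z.1| ≤ K := (norm_fst_le z).trans hz
      have h7 : l * inner ℝ e z.2 ≤ l * t' := mul_le_mul_of_nonneg_left h5 hl0
      gcongr
      refine le_trans ?_ (le_abs_self _)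
      simp only [resid, hw, real_inner_smul_left]
      linarith [le_abs_self z.1]
    have h8 := mul_le_mul_of_nonneg_left h2 hpos.le
    have h9 := mul_le_mul_of_nonneg_left h3 h0.le
    linarith
  have hbias : ENNReal.ofReal t' ≤ bias T (contam ε (Measure.dirac w)) := by
    unfold bias
    cases hz : T (contam ε (Measure.dirac w)) with
    | none => exact le_top
    | some z => exact ENNReal.ofReal_le_ofReal (hfar z ((hT _ hprob).1 z hz)).le
  refine ha'.trans_le (hbias.trans ?_)
  exact le_iSup₂ (f := fun H (_ : H ∈ contNbhd p ε) => bias T H) _ ⟨_, inferInstance, rfl⟩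


/-! ### Analysis of `g` and `φ` -/

lemma IsUnimodalAt.hasDerivAt {ρ : ℝ → ℝ} {σM : ℝ} (hu : IsUnimodalAt ρ σM) {s : ℝ} (hs : 0 < s) :
    HasDerivAt (g ρ) (-phi ρ s / s) s := by
  have h1 := ((hu.smooth.differentiableOn one_ne_zero).differentiableAt
    (Ioi_mem_nhds hs)).hasDerivAt
  have h2 : -phi ρ s / s = deriv (g ρ) s := by simp only [phi]; field_simp
  rwa [h2]

lemma IsUnimodalAt.continuousOn {ρ : ℝ → ℝ} {σM : ℝ} (hu : IsUnimodalAt ρ σM) :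
    ContinuousOn (g ρ) (Ioi 0) := hu.smooth.continuousOn

lemma IsUnimodalAt.continuousAt_phi {ρ : ℝ → ℝ} {σM : ℝ} (hu : IsUnimodalAt ρ σM) {s : ℝ}
    (hs : 0 < s) : ContinuousAt (phi ρ) s := by
  have h1 : ContinuousOn (deriv (g ρ)) (Ioi 0) :=
    hu.smooth.continuousOn_deriv_of_isOpen isOpen_Ioi le_rfl
  exact continuousAt_id.neg.mul (h1.continuousAt (Ioi_mem_nhds hs))

lemma IsUnimodalAt.hasDerivAt_add_log {ρ : ℝ → ℝ} {σM : ℝ} (hu : IsUnimodalAt ρ σM) (m : ℝ) {s : ℝ}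
    (hs : 0 < s) : HasDerivAt (fun x => g ρ x + m * Real.log x) ((m - phi ρ s) / s) s := by
  have h1 : (m - phi ρ s) / s = -phi ρ s / s + m * s⁻¹ := by ring
  rw [h1]
  exact (hu.hasDerivAt hs).add ((Real.hasDerivAt_log hs.ne').const_mul m)

/-- Because φ is the derivative of -g with respect to log s, a bound on φ over an interval is a
slope bound for g on the logarithmic scale. -/
lemma IsUnimodalAt.sub_le_mul_log {ρ : ℝ → ℝ} {σM : ℝ} (hu : IsUnimodalAt ρ σM) {m s t : ℝ}
    (hs : 0 < s) (hst : s ≤ t) (hm : ∀ x ∈ Icc s t, phi ρ x ≤ m) :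
    g ρ s - g ρ t ≤ m * Real.log (t / s) := by
  have hd : ∀ x ∈ Icc s t, HasDerivAt (fun x => g ρ x + m * Real.log x) ((m - phi ρ x) / x) x :=
    fun x hx => hu.hasDerivAt_add_log m (hs.trans_le hx.1)
  have := monotoneOn_of_deriv_nonneg (convex_Icc s t)
    (fun x hx => (hd x hx).continuousAt.continuousWithinAt)
    (fun x hx => (hd x (interior_subset hx)).differentiableAt.differentiableWithinAt)
    (fun x hx => by
      rw [(hd x (interior_subset hx)).deriv]
      exact div_nonneg (sub_nonneg.2 (hm x (interior_subset hx)))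
        (hs.le.trans (interior_subset hx : x ∈ Icc s t).1))
    (left_mem_Icc.2 hst) (right_mem_Icc.2 hst) hst
  rw [Real.log_div (hs.trans_le hst).ne' hs.ne']
  linarith

lemma IsUnimodalAt.mul_log_le_sub {ρ : ℝ → ℝ} {σM : ℝ} (hu : IsUnimodalAt ρ σM) {m s t : ℝ}
    (hs : 0 < s) (hst : s ≤ t) (hm : ∀ x ∈ Icc s t, m ≤ phi ρ x) :
    m * Real.log (t / s) ≤ g ρ s - g ρ t := by
  have hd : ∀ x ∈ Icc s t, HasDerivAt (fun x => g ρ x + m * Real.log x) ((m - phi ρ x) / x) x :=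
    fun x hx => hu.hasDerivAt_add_log m (hs.trans_le hx.1)
  have := antitoneOn_of_deriv_nonpos (convex_Icc s t)
    (fun x hx => (hd x hx).continuousAt.continuousWithinAt)
    (fun x hx => (hd x (interior_subset hx)).differentiableAt.differentiableWithinAt)
    (fun x hx => by
      rw [(hd x (interior_subset hx)).deriv]
      exact div_nonpos_of_nonpos_of_nonneg (sub_nonpos.2 (hm x (interior_subset hx)))
        (hs.le.trans (interior_subset hx : x ∈ Icc s t).1))
    (left_mem_Icc.2 hst) (right_mem_Icc.2 hst) hst
  rw [Real.log_div (hs.trans_le hst).ne' hs.ne']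
  linarith

/-- The graph of a convex `g` lies above its tangent line at `s`. -/
lemma IsUnimodalAt.tangent_le {ρ : ℝ → ℝ} {σM : ℝ} (hu : IsUnimodalAt ρ σM)
    (hc : ConvexOn ℝ (Ioi 0) (g ρ)) {s t : ℝ} (hs : 0 < s) (hst : s ≤ t) :
    g ρ s - g ρ t ≤ phi ρ s * (t / s - 1) := by
  rcases hst.eq_or_lt with rfl | hst
  · simp [hs.ne']
  have h1 := hc.le_slope_of_hasDerivAt (mem_Ioi.2 hs) (mem_Ioi.2 (hs.trans hst)) hst
    (hu.hasDerivAt hs)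
  rw [slope_def_field, le_div_iff₀ (sub_pos.2 hst)] at h1
  have : phi ρ s * (t / s - 1) = -(-phi ρ s / s * (t - s)) := by field_simp
  linarith

lemma exists_g_eq {ρ : ℝ → ℝ} (h : IsLoss ρ) (hcont : ContinuousOn (g ρ) (Ioi 0)) {s v : ℝ}
    (hs : 0 < s) (hsv : g ρ s ≤ v) (hv : v < 1) : ∃ t, 0 < t ∧ g ρ t = v := by
  obtain ⟨δ, hδ, hδg⟩ := exists_lt_g h hv
  have hd := hδg δ hδ le_rfl
  obtain ⟨t, ht, htv⟩ := (ordConnected_Ioi.isPreconnected (s := Ioi (0 : ℝ))).intermediate_value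
    (mem_Ioi.2 hs) (mem_Ioi.2 hδ) hcont ⟨hsv, hd.le⟩
  exact ⟨t, ht, htv⟩

lemma gInv_spec {ρ : ℝ → ℝ} {v : ℝ} (hv : v ∈ g ρ '' Ioi 0) : 0 < gInv ρ v ∧ g ρ (gInv ρ v) = v :=
  Function.invFunOn_pos hv

lemma gInv_eq {ρ : ℝ → ℝ} (hanti : StrictAntiOn (g ρ) (Ioi 0)) {s v : ℝ} (hs : 0 < s)
    (hsv : g ρ s = v) : gInv ρ v = s := by
  obtain ⟨h1, h2⟩ := gInv_spec (ρ := ρ) ⟨s, hs, hsv⟩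
  exact hanti.injOn h1 hs (h2.trans hsv.symm)

/-! ### Comparison of the bias bounds -/

/-- The standing assumptions, with the scale `s₀` at which `g` takes the value `b`. -/
structure Regular (ρ : ℝ → ℝ) (b σM s₀ : ℝ) : Prop where
  loss : IsLoss ρ
  b_pos : 0 < b
  b_lt : b < 1
  unimodal : IsUnimodalAt ρ σM
  g_lt : g ρ σM < b
  convex : ConvexOn ℝ (Ioi 0) (g ρ)
  pos : 0 < s₀
  g_eq : g ρ s₀ = b
  sq_le : (1 - b) ^ 2 ≤ 2 * phi ρ s₀

namespace Regular

variable {ρ : ℝ → ℝ} {b σM s₀ : ℝ}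

lemma strictAnti (hR : Regular ρ b σM s₀) : StrictAntiOn (g ρ) (Ioi 0) :=
  g_strictAnti hR.loss hR.convex hR.unimodal.pos (hR.g_lt.trans hR.b_lt)

lemma phi_pos (hR : Regular ρ b σM s₀) : 0 < phi ρ s₀ := by
  have := pow_pos (sub_pos.2 hR.b_lt) 2
  linarith [hR.sq_le]

lemma lt_max (hR : Regular ρ b σM s₀) : s₀ < σM := by
  rw [← hR.strictAnti.lt_iff_gt hR.unimodal.pos hR.pos, hR.g_eq]
  exact hR.g_lt

lemma sigma_zero (hR : Regular ρ b σM s₀) : sigma ρ b 0 = s₀ := by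
  rw [sigma, sub_zero, sub_zero, div_one]
  exact gInv_eq hR.strictAnti hR.pos hR.g_eq

/-- On [s₀, σ_M] the function g loses at least φ(s₀) per unit of log s. The loss is strictly larger
near σ_M, where φ exceeds φ(s₀); the interval is split at such a point t. -/
lemma ratio_log_lt (hR : Regular ρ b σM s₀) :
    Real.log (σM / s₀) / (b - g ρ σM) < 1 / phi ρ s₀ := by
  have hlt := hR.unimodal.max s₀ hR.pos hR.lt_max.ne
  obtain ⟨t, ht1, ht2, ht3⟩ : ∃ t, s₀ < t ∧ t < σM ∧ phi ρ s₀ < phi ρ t := by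
    have h1 := (hR.unimodal.continuousAt_phi hR.unimodal.pos).eventually (lt_mem_nhds hlt)
    obtain ⟨t, h2, h3⟩ := ((h1.filter_mono nhdsWithin_le_nhds).and
      (Ioo_mem_nhdsLT hR.lt_max)).exists
    exact ⟨t, h3.1, h3.2, h2⟩
  have ht0 := hR.pos.trans ht1
  have h1 := hR.unimodal.mul_log_le_sub hR.pos ht1.le (m := phi ρ s₀) fun x hx =>
    hR.unimodal.incr ⟨hR.pos, hR.lt_max.le⟩ ⟨hR.pos.trans_le hx.1, hx.2.trans ht2.le⟩ hx.1
  have h2 := hR.unimodal.mul_log_le_sub ht0 ht2.le (m := phi ρ t) fun x hx =>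
    hR.unimodal.incr ⟨ht0, ht2.le⟩ ⟨ht0.trans_le hx.1, hx.2⟩ hx.1
  have h3 : phi ρ s₀ * Real.log (σM / t) < phi ρ t * Real.log (σM / t) :=
    mul_lt_mul_of_pos_right ht3 (Real.log_pos ((one_lt_div ht0).2 ht2))
  have h4 : Real.log (σM / s₀) = Real.log (σM / t) + Real.log (t / s₀) := by
    rw [← Real.log_mul (div_pos hR.unimodal.pos ht0).ne' (div_pos ht0 hR.pos).ne',
      div_mul_div_cancel₀ ht0.ne']
  rw [div_lt_div_iff₀ (sub_pos.2 hR.g_lt) hR.phi_pos, h4, ← hR.g_eq]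
  linarith

lemma ratio_log_pos (hR : Regular ρ b σM s₀) : 0 < Real.log (σM / s₀) / (b - g ρ σM) :=
  div_pos (Real.log_pos ((one_lt_div hR.pos).2 hR.lt_max)) (sub_pos.2 hR.g_lt)

/-- `log (s₀ / γ)` is at least `(g γ - b) / φ(s₀)` for `γ ≤ s₀`. -/
lemma le_mul_log_left (hR : Regular ρ b σM s₀) {r : ℝ} (hr : 0 < r) (hrs : r ≤ s₀) :
    g ρ r - b ≤ phi ρ s₀ * Real.log (s₀ / r) := by
  rw [← hR.g_eq]
  exact hR.unimodal.sub_le_mul_log hr hrs fun x hx =>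
    hR.unimodal.incr ⟨hr.trans_le hx.1, hx.2.trans hR.lt_max.le⟩ ⟨hR.pos, hR.lt_max.le⟩ hx.2

/-- The tangent to g at s₀ shows how far s must move right of s₀ for g to fall from b to g(s). -/
lemma log_right_ge (hR : Regular ρ b σM s₀) {s : ℝ} (hs : s₀ ≤ s) :
    Real.log (1 + (b - g ρ s) / phi ρ s₀) ≤ Real.log (s / s₀) := by
  have h1 := hR.unimodal.tangent_le hR.convex hR.pos hs
  have h2 : g ρ s ≤ b := by
    rw [← hR.g_eq]; exact g_anti hR.loss hR.pos (hR.pos.trans_le hs) hs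
  have h3 := div_nonneg (sub_nonneg.2 h2) hR.phi_pos.le
  apply Real.log_le_log (by linarith)
  rw [hR.g_eq, mul_comm, ← div_le_iff₀ hR.phi_pos] at h1
  linarith

/-- The basic inequality for the logarithm, at contamination level `ε`. -/
lemma log_bound (hR : Regular ρ b σM s₀) {ε : ℝ} (h0 : 0 < ε) (h1 : ε < 1) :
    ε < b * ε / (1 - ε) +
      phi ρ s₀ * Real.log (1 + ε * (1 - b) / (1 - ε) / phi ρ s₀) := by
  have hφ := hR.phi_pos
  have hpos : 0 < 1 - ε := by linarith
  have ha : 0 < 1 - b := sub_pos.2 hR.b_lt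
  set f := phi ρ s₀ with hf
  have hy : 0 ≤ ε * (1 - b) / (1 - ε) / f := by positivity
  have h2 := mul_le_mul_of_nonneg_left (Real.le_log_one_add_of_nonneg hy) hφ.le
  refine lt_of_lt_of_le ?_ (add_le_add_right h2 _)
  have h3 : f * (2 * (ε * (1 - b) / (1 - ε) / f) / (ε * (1 - b) / (1 - ε) / f + 2)) =
      2 * f * ε * (1 - b) / (ε * (1 - b) + 2 * f * (1 - ε)) := by
    field_simp
  have hd : 0 < ε * (1 - b) + 2 * f * (1 - ε) := by positivity
  rw [h3, div_add_div _ _ hpos.ne' hd.ne', lt_div_iff₀ (mul_pos hpos hd)]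
  have h4 := hR.sq_le
  have hb := hR.b_pos
  -- This is the claim after inserting log(1 + y) ≥ 2y/(y + 2), clearing denominators and dividing
  -- by ε². It is what fixes the requirement (1 - b)² ≤ 2φ(s₀).
  have h5 : (1 - b) ^ 2 - ε * (1 - b) < 2 * f * (1 - ε) := by
    have h6 := mul_le_mul_of_nonneg_right h4 hpos.le
    have h7 := mul_pos (mul_pos h0 ha) hb
    linarith
  have h8 := mul_lt_mul_of_pos_left h5 (mul_pos h0 h0)
  linarith

/-- The ratio is split at s₀: monotonicity of φ handles [γ, s₀], the tangent handles [s₀, σ], and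
`log_bound` adds the two estimates. -/
lemma lt_log_ratio (hR : Regular ρ b σM s₀) {ε r s : ℝ} (h0 : 0 < ε) (h1 : ε < 1)
    (hr : 0 < r) (hrb : g ρ r = b / (1 - ε)) (hs : 0 < s) (hsb : g ρ s = (b - ε) / (1 - ε)) :
    ε / phi ρ s₀ < Real.log (s / r) := by
  have hpos : 0 < 1 - ε := by linarith
  have hrs : r ≤ s₀ := by
    rw [← hR.strictAnti.le_iff_ge hR.pos hr, hR.g_eq, hrb, le_div_iff₀ hpos]
    nlinarith [hR.b_pos]
  have hss : s₀ ≤ s := by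
    rw [← hR.strictAnti.le_iff_ge hs hR.pos, hR.g_eq, hsb, div_le_iff₀ hpos]
    nlinarith [hR.b_lt]
  have h2 := hR.le_mul_log_left hr hrs
  have h3 := mul_le_mul_of_nonneg_left (hR.log_right_ge hss) hR.phi_pos.le
  have h4 := hR.log_bound h0 h1
  have h5 : b - g ρ s = ε * (1 - b) / (1 - ε) := by rw [hsb]; field_simp; ring
  have h6 : g ρ r - b = b * ε / (1 - ε) := by rw [hrb]; field_simp; ring
  have h7 : Real.log (s / r) = Real.log (s / s₀) + Real.log (s₀ / r) := by
    rw [← Real.log_mul (div_pos hs hR.pos).ne' (div_pos hR.pos hr).ne',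
      div_mul_div_cancel₀ hR.pos.ne']
  rw [div_lt_iff₀ hR.phi_pos, h7]
  rw [h5] at h3
  linarith

lemma log_ratio_le (hR : Regular ρ b σM s₀) {ε r s : ℝ} (h0 : 0 < ε) (h1 : ε < 1)
    (hr : 0 < r) (hrb : g ρ r = b / (1 - ε)) (hs : 0 < s) (hsb : g ρ s = (b - ε) / (1 - ε))
    (hsM : s ≤ σM) (hφ : 0 < phi ρ r) :
    Real.log (s / r) ≤ ε / ((1 - ε) * phi ρ r) := by
  have hpos : 0 < 1 - ε := by linarith
  have hrs : r ≤ s := by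
    rw [← hR.strictAnti.le_iff_ge hs hr, hrb, hsb]
    gcongr; linarith
  have h2 := hR.unimodal.mul_log_le_sub hr hrs (m := phi ρ r) fun x hx =>
    hR.unimodal.incr ⟨hr, hrs.trans hsM⟩ ⟨hr.trans_le hx.1, hx.2.trans hsM⟩ hx.1
  rw [← div_div, le_div_iff₀ hφ, mul_comm]
  refine h2.trans_eq ?_
  rw [hrb, hsb]; field_simp; ring

/-- On `[γ, σ]` the function `c (1 - ε) g + log` attains its minimum at `γ`. -/
lemma objective_min (hR : Regular ρ b σM s₀) {ε r s u c : ℝ} (h0 : 0 < ε) (h1 : ε < 1)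
    (hr : 0 < r) (hrb : g ρ r = b / (1 - ε)) (hs : 0 < s) (hsb : g ρ s = (b - ε) / (1 - ε))
    (hc : 0 < c) (hcφ : c ≤ 1 / phi ρ s₀) (hru : r ≤ u) (hus : u ≤ s) :
    c * (1 - ε) * g ρ r + Real.log r ≤ c * (1 - ε) * g ρ u + Real.log u := by
  have hpos : 0 < 1 - ε := by linarith
  have hu0 : 0 < u := hr.trans_le hru
  have hφ := hR.phi_pos
  have hcφ' : c * phi ρ s₀ ≤ 1 := (le_div_iff₀ hφ).1 hcφ
  -- The constant c enters only through c φ(s₀) ≤ 1, so it can be removed.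
  suffices hsuff : (1 - ε) * (g ρ r - g ρ u) ≤ phi ρ s₀ * Real.log (u / r) by
    have h2 := mul_le_mul_of_nonneg_left hsuff hc.le
    have hlog : 0 ≤ Real.log (u / r) := Real.log_nonneg ((one_le_div hr).2 hru)
    have h3 := mul_le_mul_of_nonneg_right hcφ' hlog
    rw [Real.log_div hu0.ne' hr.ne'] at h2 h3
    linarith
  rcases le_total u s₀ with hle | hle
  · have h2 := hR.unimodal.sub_le_mul_log hr hru (m := phi ρ s₀) fun x hx =>
      hR.unimodal.incr ⟨hr.trans_le hx.1, hx.2.trans (hle.trans hR.lt_max.le)⟩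
        ⟨hR.pos, hR.lt_max.le⟩ (hx.2.trans hle)
    have h3 : 0 ≤ g ρ r - g ρ u := sub_nonneg.2 (g_anti hR.loss hr hu0 hru)
    nlinarith
  · have h2 := hR.le_mul_log_left hr (by
      rw [← hR.strictAnti.le_iff_ge hR.pos hr, hR.g_eq, hrb, le_div_iff₀ hpos]
      nlinarith [hR.b_pos])
    have h3 := mul_le_mul_of_nonneg_left (hR.log_right_ge hle) hφ.le
    have h4 := hR.log_bound h0 h1
    have h7 : Real.log (u / r) = Real.log (u / s₀) + Real.log (s₀ / r) := by
      rw [← Real.log_mul (div_pos hu0 hR.pos).ne' (div_pos hR.pos hr).ne',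
        div_mul_div_cancel₀ hR.pos.ne']
    set d := b - g ρ u with hd
    set dm := ε * (1 - b) / (1 - ε) with hdm
    have hdm0 : 0 < dm := div_pos (mul_pos h0 (sub_pos.2 hR.b_lt)) hpos
    have hd0 : 0 ≤ d := by
      rw [hd, ← hR.g_eq]; exact sub_nonneg.2 (g_anti hR.loss hR.pos hu0 hle)
    have hdd : d ≤ dm := by
      have h5 : b - g ρ s = dm := by rw [hsb, hdm]; field_simp; ring
      rw [← h5, hd]
      linarith [g_anti hR.loss hu0 hs hus]
    -- Concavity of log interpolates between s₀ and the endpoint σ: d/dm is the fraction of the drop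
    -- of g from s₀ to σ already reached at u. So `log_bound`, known for the full drop, may be
    -- scaled by d/dm.
    have hconc : d / dm * Real.log (1 + dm / phi ρ s₀) ≤ Real.log (1 + d / phi ρ s₀) := by
      have h8 := strictConcaveOn_log_Ioi.concaveOn.2 (mem_Ioi.2 one_pos)
        (mem_Ioi.2 (by positivity : 0 < 1 + dm / phi ρ s₀))
        (sub_nonneg.2 ((div_le_one hdm0).2 hdd)) (div_nonneg hd0 hdm0.le) (by ring)
      simp only [smul_eq_mul, Real.log_one, mul_zero, zero_add] at h8
      have h9 : (1 - d / dm) * 1 + d / dm * (1 + dm / phi ρ s₀) = 1 + d / phi ρ s₀ := by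
        field_simp
        ring
      rwa [h9] at h8
    have h9 := mul_le_mul_of_nonneg_left hconc hφ.le
    have h10 := mul_le_mul_of_nonneg_left h4.le (div_nonneg hd0 hdm0.le)
    have h11 : g ρ r - b = b * ε / (1 - ε) := by rw [hrb]; field_simp; ring
    have h12 : (1 - ε) * (g ρ r - g ρ u) = b * ε + (1 - ε) * d := by
      rw [hrb, hd]; field_simp; ring
    have h13 : (1 - d / dm) * (b * ε) ≤ (1 - d / dm) * (b * ε / (1 - ε)) := by
      refine mul_le_mul_of_nonneg_left ?_ (sub_nonneg.2 ((div_le_one hdm0).2 hdd))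
      rw [le_div_iff₀ hpos]
      have := mul_pos hR.b_pos h0
      nlinarith
    have h14 : d / dm * ε = b * (d / dm * ε) + (1 - ε) * d := by
      rw [hdm]
      have := (sub_pos.2 hR.b_lt).ne'
      field_simp
      ring
    rw [h12, h7]
    rw [h11] at h2
    linarith

end Regular


/-! ### The infimum `c_o` and the comparison of the maximum bias functions -/

namespace Regular

variable {ρ : ℝ → ℝ} {b σM s₀ : ℝ}

/-- Contamination levels close to `0`, parametrized by `γ` close to `s₀`. -/
lemma exists_level (hR : Regular ρ b σM s₀) {P : ℝ × ℝ → Prop} (hP : ∀ᶠ q in 𝓝 (s₀, 0), P q) :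
    ∃ r ε s, 0 < r ∧ 0 < ε ∧ ε < b ∧ ε < 1 - b ∧ g ρ r = b / (1 - ε) ∧ 0 < s ∧ s ≤ σM ∧
      g ρ s = (b - ε) / (1 - ε) ∧ P (r, ε) := by
  have hgc : ContinuousAt (g ρ) s₀ := hR.unimodal.continuousOn.continuousAt (Ioi_mem_nhds hR.pos)
  have hlim : Tendsto (fun r => (r, 1 - b / g ρ r)) (𝓝 s₀) (𝓝 (s₀, 0)) := by
    have h1 : ContinuousAt (fun r => (r, 1 - b / g ρ r)) s₀ :=
      continuousAt_id.prodMk (continuousAt_const.sub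
        (continuousAt_const.div hgc (by rw [hR.g_eq]; exact hR.b_pos.ne')))
    have h2 := h1.tendsto
    rwa [hR.g_eq, div_self hR.b_pos.ne', sub_self] at h2
  have hlim2 := (continuous_snd.tendsto (s₀, (0 : ℝ))).comp hlim
  have hv : ∀ᶠ ε in 𝓝 (0 : ℝ), g ρ σM < (b - ε) / (1 - ε) := by
    have h1 : ContinuousAt (fun ε : ℝ => (b - ε) / (1 - ε)) 0 :=
      (continuousAt_const.sub continuousAt_id).div (continuousAt_const.sub continuousAt_id)
        (by simp)
    exact h1.tendsto.eventually (lt_mem_nhds (by simpa using hR.g_lt))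
  have hev := ((hlim.eventually hP).and ((hlim2.eventually hv).and
    ((hlim2.eventually (gt_mem_nhds hR.b_pos)).and
      (hlim2.eventually (gt_mem_nhds (sub_pos.2 hR.b_lt)))))).filter_mono
        (nhdsWithin_le_nhds (s := Iio s₀))
  obtain ⟨r, ⟨h1, h2, h3, h4⟩, h5⟩ := (hev.and (Ioo_mem_nhdsLT hR.pos)).exists
  simp only [Function.comp] at h2 h3 h4
  set ε := 1 - b / g ρ r with hε
  have hgr : b < g ρ r := by
    rw [← hR.g_eq]; exact hR.strictAnti h5.1 hR.pos h5.2
  have hgr0 := hR.b_pos.trans hgr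
  have hε0 : 0 < ε := by
    rw [hε, sub_pos, div_lt_one hgr0]; exact hgr
  have hpos : 0 < 1 - ε := by linarith [hR.b_pos]
  obtain ⟨s, hs, hsv⟩ := exists_g_eq hR.loss hR.unimodal.continuousOn hR.unimodal.pos h2.le
    (by rw [div_lt_one hpos]; linarith [hR.b_lt])
  refine ⟨r, ε, s, h5.1, hε0, h3, h4, ?_, hs, ?_, hsv, h1⟩
  · have : 1 - ε = b / g ρ r := by rw [hε]; ring
    rw [this, div_div_cancel₀ hR.b_pos.ne']
  · rw [← hR.strictAnti.le_iff_ge hR.unimodal.pos hs, hsv]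
    exact h2.le

/-- The lower bound is `lt_log_ratio`. It is approached as ε → 0, since c(ε) ≤ 1/((1 - ε)φ(γ)) by
`log_ratio_le` and γ → s₀. -/
lemma isGLB_cSet (hR : Regular ρ b σM s₀) : IsGLB (cSet ρ b) (1 / phi ρ s₀) := by
  constructor
  · rintro _ ⟨ε, h0, hb, hs, hr, rfl⟩
    obtain ⟨hs0, hsg⟩ := gInv_spec hs
    obtain ⟨hr0, hrg⟩ := gInv_spec hr
    have h1 := hR.lt_log_ratio h0 (hb.trans hR.b_lt) hr0 hrg hs0 hsg
    rw [sigma, gam, inv_mul_eq_div, le_div_iff₀ h0, one_div_mul_eq_div]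
    exact h1.le
  · intro l hl
    by_contra! hcon
    have hφc := hR.unimodal.continuousAt_phi hR.pos
    have hc2 : ContinuousAt (fun q : ℝ × ℝ => phi ρ q.1) (s₀, 0) :=
      ContinuousAt.comp (f := Prod.fst) (g := phi ρ) (x := ((s₀, 0) : ℝ × ℝ)) hφc continuousAt_fst
    have hc1 : ContinuousAt (fun q : ℝ × ℝ => 1 / ((1 - q.2) * phi ρ q.1)) (s₀, 0) :=
      continuousAt_const.div ((continuousAt_const.sub continuousAt_snd).mul hc2)
        (by simpa using hR.phi_pos.ne')
    obtain ⟨r, ε, s, hr, h0, hεb, hε1, hrg, hs, hsM, hsg, h2, h3⟩ :=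
      hR.exists_level ((hc1.tendsto.eventually
        (gt_mem_nhds (show 1 / ((1 - 0) * phi ρ s₀) < l by simpa using hcon))).and
        (hc2.tendsto.eventually (lt_mem_nhds hR.phi_pos)))
    have h1 : ε < 1 := by linarith [hR.b_pos]
    have h4 := hR.log_ratio_le h0 h1 hr hrg hs hsg hsM h3
    have h5 : l ≤ ε⁻¹ * Real.log (s / r) :=
      hl ⟨ε, h0, hεb, ⟨s, hs, hsg⟩, ⟨r, hr, hrg⟩, by
        rw [sigma, gam, gInv_eq hR.strictAnti hs hsg, gInv_eq hR.strictAnti hr hrg]⟩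
    rw [inv_mul_eq_div, le_div_iff₀ h0] at h5
    have h6 := mul_lt_mul_of_pos_right h2 h0
    rw [one_div_mul_eq_div] at h6
    linarith

lemma le_maxBias_s_of_lt (hR : Regular ρ b σM s₀) {p : ℕ} (hp : 0 < p) {ε r s : ℝ}
    (h0 : 0 < ε) (h1 : ε < 1 - b) (hr : 0 < r) (hrg : g ρ r = b / (1 - ε)) (hs : 0 < s)
    (hsg : (b - ε) / (1 - ε) ≤ g ρ s) {T : Functional p} (hT : IsSFunctional ρ b T) :
    ENNReal.ofReal √((s / r) ^ 2 - 1) ≤ maxBias T ε := by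
  have hpos : 0 < 1 - ε := by linarith [hR.b_pos]
  refine le_of_forall_lt_imp_le_of_dense fun a ha => ?_
  have ha' : a ≠ ⊤ := ha.ne_top
  obtain ⟨t, ht0, rfl⟩ : ∃ t : ℝ, 0 ≤ t ∧ ENNReal.ofReal t = a :=
    ⟨a.toReal, ENNReal.toReal_nonneg, ENNReal.ofReal_toReal ha'⟩
  have ht : t < √((s / r) ^ 2 - 1) := by
    by_contra! hcon
    exact absurd ha (not_lt.2 (ENNReal.ofReal_le_ofReal hcon))
  rw [Real.lt_sqrt ht0] at ht
  have h2 : √(1 + t ^ 2) * r < s := by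
    rw [← lt_div_iff₀ hr, Real.sqrt_lt' (div_pos hs hr)]
    linarith
  obtain ⟨s', h3, h4⟩ := exists_between h2
  have hs' : 0 < s' := (mul_nonneg (Real.sqrt_nonneg _) hr.le).trans_lt h3
  have h5 := hsg.trans_lt (hR.strictAnti hs' hs h4)
  rw [div_lt_iff₀ hpos] at h5
  exact le_maxBias_s hp hR.loss h0 h1 hR.b_pos hr (by rw [hrg]; field_simp) h3 (by linarith) ht0 hT

/-- If g never falls to (b - ε)/(1 - ε), the previous bound holds for arbitrarily large s, and s =
√(1 + t²) r yields a bias of at least t for every t. -/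
lemma maxBias_s_eq_top_of_notMem (hR : Regular ρ b σM s₀) {p : ℕ} (hp : 0 < p) {ε r : ℝ}
    (h0 : 0 < ε) (h1 : ε < 1 - b) (hr : 0 < r) (hrg : g ρ r = b / (1 - ε))
    (hv : (b - ε) / (1 - ε) ∉ g ρ '' Ioi 0) {T : Functional p} (hT : IsSFunctional ρ b T) :
    maxBias T ε = ⊤ := by
  have hpos : 0 < 1 - ε := by linarith [hR.b_pos]
  have hall : ∀ s, 0 < s → (b - ε) / (1 - ε) ≤ g ρ s := fun s hs => by
    by_contra! hcon
    exact hv (exists_g_eq hR.loss hR.unimodal.continuousOn hs hcon.le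
      (by rw [div_lt_one hpos]; linarith [hR.b_lt]))
  refine ENNReal.eq_top_of_forall_nnreal_le fun t => ?_
  have h2 := hR.le_maxBias_s_of_lt hp h0 h1 hr hrg (s := √(1 + (t : ℝ) ^ 2) * r) (by positivity)
    (hall _ (by positivity)) hT
  rwa [mul_div_cancel_right₀ _ hr.ne', Real.sq_sqrt (by positivity), add_sub_cancel_left,
    Real.sqrt_sq t.coe_nonneg, ENNReal.ofReal_coe_nnreal] at h2

lemma maxBias_cm_le_s (hR : Regular ρ b σM s₀) {p : ℕ} (hp : 0 < p) {c : ℝ} (hc : 0 < c)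
    (hcφ : c ≤ 1 / phi ρ s₀) {TS TCM : Functional p} (hTS : IsSFunctional ρ b TS)
    (hTCM : IsCMFunctional ρ b c TCM) {ε : ℝ} (hε : ε ∈ Icc (0 : ℝ) 1) :
    maxBias TCM ε ≤ maxBias TS ε := by
  rcases le_or_gt (1 - b) ε with h1 | h1
  · rw [maxBias_s_eq_top hR.loss hε.1 hε.2 h1 hTS]
    exact le_top
  rcases hε.1.eq_or_lt with rfl | h0
  · refine (maxBias_cm_le hR.loss hc hR.b_pos le_rfl h1 hR.strictAnti hR.pos (s := s₀)
      (by rw [hR.g_eq]; ring) hR.pos (by rw [hR.g_eq]; ring) (D := 0)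
      (fun u hu => ⟨u, hu, by linarith⟩) hTCM).trans ?_
    simp
  have hpos : 0 < 1 - ε := by linarith [hR.b_pos]
  have hlt1 : ε < 1 := by linarith
  obtain ⟨r, hr, hrg⟩ := exists_g_eq hR.loss hR.unimodal.continuousOn hR.unimodal.pos
    (v := b / (1 - ε)) (by rw [le_div_iff₀ hpos]; nlinarith [hR.g_lt, g_nonneg hR.loss σM])
    (by rw [div_lt_one hpos]; linarith)
  by_cases hv : (b - ε) / (1 - ε) ∈ g ρ '' Ioi 0
  · obtain ⟨s, hs, hsg⟩ := hv
    have hs0 : 0 < s := hs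
    have hlog := hR.lt_log_ratio h0 hlt1 hr hrg hs hsg
    have hcε : c * ε ≤ Real.log (s / r) := by
      have := mul_le_mul_of_nonneg_right hcφ h0.le
      rw [one_div_mul_eq_div] at this
      linarith
    have hrg' : (1 - ε) * g ρ r = b := by rw [hrg]; field_simp
    have hsg' : (1 - ε) * g ρ s + ε = b := by rw [hsg]; field_simp; ring
    have hcm := maxBias_cm_le hR.loss hc hR.b_pos h0.le h1 hR.strictAnti hr hrg' hs hsg'
      (D := Real.log (s / r)) (fun u hu => by
        -- For u ≥ σ the same scale serves at (0, 0), at extra cost cε. For u ≤ σ the scale σ is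
        -- used: both constraints bind at the endpoints, so the loss terms both become cb and
        -- exactly log(σ/γ) remains.
        rcases le_total s u with hsu | hsu
        · exact ⟨u, hsu, by linarith⟩
        · refine ⟨s, le_rfl, ?_⟩
          have h2 := hR.objective_min h0 hlt1 hr hrg hs hsg hc hcφ hu hsu
          rw [Real.log_div hs0.ne' hr.ne']
          have h3 : c * (1 - ε) * g ρ s = c * (b - ε) := by rw [← hsg']; ring
          have h4 : c * (1 - ε) * g ρ r = c * b := by rw [← hrg']; ring
          linarith) hTCM
    rw [Real.exp_log (div_pos hs hr)] at hcm
    exact hcm.trans (hR.le_maxBias_s_of_lt hp h0 h1 hr hrg hs hsg.ge hTS)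
  · rw [hR.maxBias_s_eq_top_of_notMem hp h0 h1 hr hrg hv hTS]
    exact le_top

lemma exists_maxBias_cm_lt_s (hR : Regular ρ b σM s₀) {p : ℕ} (hp : 0 < p) {c : ℝ}
    (hc₁ : Real.log (σM / s₀) / (b - g ρ σM) < c)
    (hcφ : c ≤ 1 / phi ρ s₀) {TS TCM : Functional p} (hTS : IsSFunctional ρ b TS)
    (hTCM : IsCMFunctional ρ b c TCM) : ∃ ε ∈ Ioo (0 : ℝ) 1, maxBias TCM ε < maxBias TS ε := by
  have hc : 0 < c := hR.ratio_log_pos.trans hc₁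
  have hcont : ContinuousAt (fun q : ℝ × ℝ => c * (b - q.2) + Real.log q.1 -
      (c * (1 - q.2) * g ρ σM + Real.log σM)) (s₀, 0) := by
    have h1 : ContinuousAt (fun q : ℝ × ℝ => Real.log q.1) (s₀, 0) :=
      continuousAt_fst.log hR.pos.ne'
    fun_prop
  -- At ε = 0, where γ = σ = s₀, the condition c > c₁ says that c g + log is smaller at σ_M than at
  -- s₀. Continuity carries this to small ε.
  have h0' : 0 < c * (b - 0) + Real.log s₀ - (c * (1 - 0) * g ρ σM + Real.log σM) := by
    rw [div_lt_iff₀ (sub_pos.2 hR.g_lt), Real.log_div hR.unimodal.pos.ne' hR.pos.ne'] at hc₁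
    linarith
  obtain ⟨r, ε, s, hr, h0, hεb, hε1, hrg, hs, hsM, hsg, h2⟩ :=
    hR.exists_level (hcont.tendsto.eventually (lt_mem_nhds h0'))
  have hlt1 : ε < 1 := by linarith [hR.b_pos]
  have hpos : 0 < 1 - ε := by linarith
  have hlog := hR.lt_log_ratio h0 hlt1 hr hrg hs hsg
  have hcε : c * ε < Real.log (s / r) := by
    have := mul_le_mul_of_nonneg_right hcφ h0.le
    rw [one_div_mul_eq_div] at this
    linarith
  have hsg' : (1 - ε) * g ρ s + ε = b := by rw [hsg]; field_simp; ring
  have hcm := maxBias_cm_le hR.loss hc hR.b_pos h0.le hε1 hR.strictAnti hr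
    (by rw [hrg]; field_simp) hs hsg' (D := c * ε) (fun u hu => by
      rcases le_total s u with hsu | hsu
      · exact ⟨u, hsu, by linarith⟩
      · refine ⟨σM, hsM, ?_⟩
        have hu0 := hr.trans_le hu
        have h3 := mul_le_mul_of_nonneg_left (g_anti hR.loss hu0 hs hsu) (mul_pos hc hpos).le
        have h4 : c * (1 - ε) * g ρ s = c * (b - ε) := by rw [← hsg']; ring
        have h5 := Real.log_le_log hr hu
        linarith) hTCM
  refine ⟨ε, ⟨h0, hlt1⟩, hcm.trans_lt (lt_of_lt_of_le ?_
    (hR.le_maxBias_s_of_lt hp h0 hε1 hr hrg hs hsg.ge hTS))⟩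
  have h6 : Real.exp (c * ε) < s / r := by
    rwa [← Real.lt_log_iff_exp_lt (div_pos hs hr)]
  have h7 : Real.exp (c * ε) ^ 2 < (s / r) ^ 2 := by gcongr
  have h8 : 1 ≤ Real.exp (c * ε) ^ 2 := one_le_pow₀ (Real.one_le_exp (by positivity))
  rw [ENNReal.ofReal_lt_ofReal_iff (Real.sqrt_pos.2 (by linarith))]
  exact Real.sqrt_lt_sqrt (by linarith) (by linarith)

lemma cmDominatesS (hR : Regular ρ b σM s₀) {p : ℕ} (hp : 0 < p) {c : ℝ}
    (hc₁ : Real.log (σM / s₀) / (b - g ρ σM) < c) (hcφ : c ≤ 1 / phi ρ s₀) :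
    CMDominatesS p ρ b c := fun _ _ hTS hTCM =>
  ⟨fun _ hε => hR.maxBias_cm_le_s hp (hR.ratio_log_pos.trans hc₁) hcφ hTS hTCM hε,
    hR.exists_maxBias_cm_lt_s hp hc₁ hcφ hTS hTCM⟩

lemma sInadmissible (hR : Regular ρ b σM s₀) {p : ℕ} (hp : 0 < p) : SInadmissible p ρ b :=
  ⟨1 / phi ρ s₀, one_div_pos.2 hR.phi_pos, hR.cmDominatesS hp hR.ratio_log_lt le_rfl⟩

end Regular

lemma exists_regular {ρ : ℝ → ℝ} {b σM : ℝ} (h : IsLoss ρ) (hb : 0 < b) (hb1 : b < 1)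
    (hu : IsUnimodalAt ρ σM) (hg : g ρ σM < b) (hconv : ConvexOn ℝ (Ioi 0) (g ρ))
    (hφ : ∀ s, 0 < s → g ρ s = b → (1 - b) ^ 2 ≤ 2 * phi ρ s) :
    ∃ s₀, Regular ρ b σM s₀ := by
  obtain ⟨s₀, hs₀, hs⟩ := exists_g_eq h hu.continuousOn hu.pos hg.le hb1
  exact ⟨s₀, h, hb, hb1, hu, hg, hconv, hs₀, hs, hφ s₀ hs₀ hs⟩


/-! ### The loss function of the quantile estimates -/

lemma isLoss_quantLoss : IsLoss quantLoss where
  symm u := by simp [quantLoss, indicator]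
  mono u hu v hv huv := by
    rw [mem_Ici] at hu hv
    simp only [quantLoss, indicator, mem_ofPred_eq, abs_of_nonneg hu, abs_of_nonneg hv]
    split_ifs <;> linarith
  zero := by simp [quantLoss]
  lim := by
    refine tendsto_const_nhds.congr' ?_
    filter_upwards [eventually_ge_atTop 1] with u hu
    simp [quantLoss, hu.trans (le_abs_self u)]
  finite_disc := by
    refine (Set.toFinite {-1, 1}).subset fun u hu => ?_
    by_contra hcon
    simp only [mem_insert_iff, mem_singleton_iff, not_or] at hcon
    refine hu ?_
    have hne : |u| ≠ 1 := fun h => (eq_or_eq_neg_of_abs_eq h).elim hcon.2 hcon.1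
    rcases lt_or_gt_of_ne hne with h | h
    · refine (continuousAt_const (y := (0 : ℝ))).congr ?_
      filter_upwards [continuous_abs.continuousAt.eventually (gt_mem_nhds h)] with v hv
      simp [quantLoss, hv]
    · refine (continuousAt_const (y := (1 : ℝ))).congr ?_
      filter_upwards [continuous_abs.continuousAt.eventually (lt_mem_nhds h)] with v hv
      simp [quantLoss, le_of_lt hv]

lemma continuous_gaussianPDFReal : Continuous (gaussianPDFReal 0 1) := by
  unfold gaussianPDFReal
  fun_prop

lemma gaussianPDFReal_zero_one (x : ℝ) :
    gaussianPDFReal 0 1 x = (√(2 * Real.pi))⁻¹ * Real.exp (-x ^ 2 / 2) := by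
  simp [gaussianPDFReal]

lemma gaussianPDFReal_anti : AntitoneOn (gaussianPDFReal 0 1) (Ici 0) := fun s hs t _ hst => by
  rw [gaussianPDFReal_zero_one, gaussianPDFReal_zero_one]
  refine mul_le_mul_of_nonneg_left (Real.exp_le_exp.2 ?_) (by positivity)
  have := pow_le_pow_left₀ (mem_Ici.1 hs) hst 2
  linarith

lemma gaussianReal_abs_lt {s : ℝ} (hs : 0 ≤ s) :
    (gaussianReal 0 1).real {z : ℝ | |z| < s} = ∫ x in -s..s, gaussianPDFReal 0 1 x := by
  have h1 : {z : ℝ | |z| < s} = Ioo (-s) s := by ext z; simp [abs_lt]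
  rw [measureReal_def, gaussianReal_apply_eq_integral 0 one_ne_zero, h1, ENNReal.toReal_ofReal
    (integral_nonneg fun x => gaussianPDFReal_nonneg 0 1 x),
    intervalIntegral.integral_of_le (by linarith), integral_Ioc_eq_integral_Ioo]

lemma g_quantLoss_eq_sub {s : ℝ} (hs : 0 < s) :
    g quantLoss s = 1 - (gaussianReal 0 1).real {z : ℝ | |z| < s} := by
  have h1 : (fun z => quantLoss (z / s)) = indicator {z : ℝ | |z| < s}ᶜ 1 := by
    ext z
    simp [quantLoss, indicator, abs_div, abs_of_pos hs, ← not_lt, div_lt_one hs]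
  have hm : MeasurableSet {z : ℝ | |z| < s} := measurableSet_lt measurable_abs measurable_const
  rw [g, h1, integral_indicator_one hm.compl, probReal_compl_eq_one_sub hm]

lemma hasDerivAt_integral_gaussianPDFReal (s : ℝ) :
    HasDerivAt (fun s => 1 - ∫ x in -s..s, gaussianPDFReal 0 1 x) (-(2 * gaussianPDFReal 0 1 s)) s := by
  have hc := continuous_gaussianPDFReal
  have hI : ∀ s, HasDerivAt (fun s => ∫ x in (0 : ℝ)..s, gaussianPDFReal 0 1 x)
      (gaussianPDFReal 0 1 s) s := fun s => hc.integral_hasStrictDerivAt 0 s |>.hasDerivAt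
  have h1 : (fun s => 1 - ∫ x in -s..s, gaussianPDFReal 0 1 x) = fun s =>
      1 - ((∫ x in (0 : ℝ)..s, gaussianPDFReal 0 1 x) -
        ∫ x in (0 : ℝ)..(-s), gaussianPDFReal 0 1 x) := by
    ext s
    rw [intervalIntegral.integral_interval_sub_left (hc.intervalIntegrable _ _)
      (hc.intervalIntegrable _ _)]
  have h2 : gaussianPDFReal 0 1 (-s) = gaussianPDFReal 0 1 s := by
    simp [gaussianPDFReal_zero_one]
  rw [h1]
  have h3 := ((hI s).sub ((hI (-s)).comp s (hasDerivAt_neg s))).const_sub 1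
  rw [h2, mul_neg_one, sub_neg_eq_add, ← two_mul] at h3
  exact h3

lemma g_quantLoss_eqOn :
    EqOn (g quantLoss) (fun s => 1 - ∫ x in -s..s, gaussianPDFReal 0 1 x) (Ioi 0) := fun s hs => by
  rw [g_quantLoss_eq_sub hs, gaussianReal_abs_lt (le_of_lt hs)]

lemma hasDerivAt_g_quantLoss {s : ℝ} (hs : 0 < s) :
    HasDerivAt (g quantLoss) (-(2 * gaussianPDFReal 0 1 s)) s :=
  (hasDerivAt_integral_gaussianPDFReal s).congr_of_eventuallyEq
    (g_quantLoss_eqOn.eventuallyEq_of_mem (Ioi_mem_nhds hs))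

lemma phi_quantLoss {s : ℝ} (hs : 0 < s) : phi quantLoss s = 2 * s * gaussianPDFReal 0 1 s := by
  rw [phi, (hasDerivAt_g_quantLoss hs).deriv]
  ring

lemma convexOn_g_quantLoss : ConvexOn ℝ (Ioi 0) (g quantLoss) := by
  refine MonotoneOn.convexOn_of_deriv (convex_Ioi 0)
    (fun s hs => (hasDerivAt_g_quantLoss hs).continuousAt.continuousWithinAt) ?_ ?_ <;>
    rw [interior_Ioi]
  · exact fun s hs => (hasDerivAt_g_quantLoss hs).differentiableAt.differentiableWithinAt
  · intro s hs t ht hst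
    rw [(hasDerivAt_g_quantLoss hs).deriv, (hasDerivAt_g_quantLoss ht).deriv]
    linarith [gaussianPDFReal_anti (mem_Ici.2 (le_of_lt hs)) (mem_Ici.2 (le_of_lt ht)) hst]

/-- Comparison of the values of `x exp (-x² / 2)`. -/
lemma phi_quantLoss_le {s t : ℝ} (hs : 0 < s) (ht : 0 < t)
    (h : s ≤ t * Real.exp ((s ^ 2 - t ^ 2) / 2)) : phi quantLoss s ≤ phi quantLoss t := by
  rw [phi_quantLoss hs, phi_quantLoss ht, gaussianPDFReal_zero_one, gaussianPDFReal_zero_one]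
  have h1 : Real.exp ((s ^ 2 - t ^ 2) / 2) * Real.exp (-s ^ 2 / 2) = Real.exp (-t ^ 2 / 2) := by
    rw [← Real.exp_add]; congr 1; ring
  rw [← h1]
  have h2 := mul_le_mul_of_nonneg_right h
    (by positivity : 0 ≤ 2 * (√(2 * Real.pi))⁻¹ * Real.exp (-s ^ 2 / 2))
  linarith

lemma isUnimodalAt_quantLoss : IsUnimodalAt quantLoss 1 where
  pos := one_pos
  smooth := by
    refine ContDiffOn.congr (ContDiff.contDiffOn ?_) g_quantLoss_eqOn
    rw [contDiff_one_iff_deriv]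
    refine ⟨fun s => (hasDerivAt_integral_gaussianPDFReal s).differentiableAt, ?_⟩
    rw [funext fun s => (hasDerivAt_integral_gaussianPDFReal s).deriv]
    exact (continuous_gaussianPDFReal.const_mul 2).neg
  incr s hs t ht hst := by
    refine phi_quantLoss_le hs.1 ht.1 ?_
    have h1 := mul_le_mul_of_nonneg_left (Real.add_one_le_exp ((s ^ 2 - t ^ 2) / 2)) ht.1.le
    -- After exp x ≥ 1 + x, the remaining difference is (t - s)(1 - t(t + s)/2).
    have h2 : t * (t + s) ≤ 2 := by nlinarith [hs.1, ht.1, ht.2, hs.2]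
    nlinarith [mul_le_mul_of_nonneg_left h2 (sub_nonneg.2 hst)]
  decr s hs t ht hst := by
    rw [mem_Ici] at hs ht
    have hs0 : 0 < s := by linarith
    have ht0 : 0 < t := by linarith
    refine phi_quantLoss_le ht0 hs0 ?_
    have h1 := mul_le_mul_of_nonneg_left (Real.add_one_le_exp ((t ^ 2 - s ^ 2) / 2)) hs0.le
    have h2 : 2 ≤ s * (t + s) := by nlinarith
    nlinarith [mul_le_mul_of_nonneg_left h2 (sub_nonneg.2 hst)]
  max s hs hne := by
    rw [phi_quantLoss hs, phi_quantLoss one_pos, gaussianPDFReal_zero_one, gaussianPDFReal_zero_one]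
    have h1 : Real.exp ((s ^ 2 - 1) / 2) * Real.exp (-s ^ 2 / 2) = Real.exp (-1 ^ 2 / 2) := by
      rw [← Real.exp_add]; congr 1; ring
    rw [← h1]
    have h3 := Real.add_one_le_exp ((s ^ 2 - 1) / 2)
    have h4 : 0 < (s - 1) ^ 2 := by positivity [sub_ne_zero.2 hne]
    have h5 : s < Real.exp ((s ^ 2 - 1) / 2) := by linarith
    have h2 := mul_lt_mul_of_pos_right h5
      (by positivity : 0 < 2 * (√(2 * Real.pi))⁻¹ * Real.exp (-s ^ 2 / 2))
    linarith

/-- With f the normal density, 1 - g(s) = P(|Z| < s) ≤ 2s f(0) ≤ 4s f(s) = 2φ(s), because exp(-1/2)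
≥ 1/2; squaring a number in [0, 1] only lowers it. The lower bound on φ is thus automatic for
quantile losses. -/
lemma sq_le_phi_quantLoss {s : ℝ} (hs : 0 < s) (hs1 : s ≤ 1) :
    (1 - g quantLoss s) ^ 2 ≤ 2 * phi quantLoss s := by
  have hL := isLoss_quantLoss
  have h0 := g_nonneg hL s
  have h1 : g quantLoss s ≤ 1 := by
    rw [g_quantLoss_eq_sub hs]; linarith [measureReal_nonneg (μ := gaussianReal 0 1) (s := {z : ℝ | |z| < s})]
  have h2 : 1 - g quantLoss s ≤ 2 * s * gaussianPDFReal 0 1 0 := by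
    rw [g_quantLoss_eqOn hs, sub_sub_cancel]
    have h3 := intervalIntegral.integral_mono_on (a := -s) (b := s) (μ := volume) (by linarith)
      (continuous_gaussianPDFReal.intervalIntegrable _ _)
      (continuous_const.intervalIntegrable _ _) (g := fun _ => gaussianPDFReal 0 1 0)
      fun x _ => by
        rw [gaussianPDFReal_zero_one, gaussianPDFReal_zero_one]
        refine mul_le_mul_of_nonneg_left (Real.exp_le_exp.2 ?_) (by positivity)
        linarith [sq_nonneg x]
    refine h3.trans_eq ?_
    rw [intervalIntegral.integral_const, smul_eq_mul]
    ring
  have h4 : gaussianPDFReal 0 1 0 ≤ 2 * gaussianPDFReal 0 1 s := by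
    have h5 := gaussianPDFReal_anti (mem_Ici.2 hs.le) (mem_Ici.2 zero_le_one) hs1
    refine le_trans ?_ (mul_le_mul_of_nonneg_left h5 two_pos.le)
    rw [gaussianPDFReal_zero_one, gaussianPDFReal_zero_one]
    have h6 := Real.add_one_le_exp (-1 ^ 2 / 2 : ℝ)
    have h7 : (0 : ℝ) ≤ (√(2 * Real.pi))⁻¹ := by positivity
    have h8 : (1 : ℝ) ≤ 2 * Real.exp (-1 ^ 2 / 2) := by linarith
    have h9 : Real.exp (-0 ^ 2 / 2 : ℝ) = 1 := by simp
    rw [h9]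
    linarith [mul_le_mul_of_nonneg_left h8 h7]
  rw [phi_quantLoss hs]
  have h8 := mul_le_mul_of_nonneg_left h4 (by positivity : 0 ≤ 2 * s)
  nlinarith

lemma sInadmissible_quantLoss {p : ℕ} (hp : 0 < p) {α : ℝ} (h0 : 0 < α)
    (h1 : α < (gaussianReal 0 1).real {z : ℝ | |z| < 1}) : SInadmissible p quantLoss (1 - α) := by
  have hg : g quantLoss 1 < 1 - α := by
    rw [g_quantLoss_eq_sub one_pos]; linarith
  obtain ⟨s₀, hR⟩ := exists_regular isLoss_quantLoss
    (by linarith [g_nonneg isLoss_quantLoss 1]) (by linarith) isUnimodalAt_quantLoss hg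
    convexOn_g_quantLoss fun s hs hsb => by
      rw [← hsb]
      refine sq_le_phi_quantLoss hs ?_
      by_contra! hcon
      have := g_anti isLoss_quantLoss (mem_Ioi.2 one_pos) (mem_Ioi.2 hs) hcon.le
      linarith
  exact hR.sInadmissible hp

/-- Integrating exp(-x²/2) ≥ 1 - x²/2 over [-1, 1] gives 5/3, and √(2π) < 10/3. -/
lemma half_lt_gaussianReal_abs_lt_one : 1 / 2 < (gaussianReal 0 1).real {z : ℝ | |z| < 1} := by
  rw [gaussianReal_abs_lt zero_le_one]
  have h1 := intervalIntegral.integral_mono_on (a := -1) (b := 1) (μ := volume) (by norm_num)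
    (f := fun x => (√(2 * Real.pi))⁻¹ * (1 - x ^ 2 / 2))
    ((by fun_prop : Continuous fun x : ℝ => (√(2 * Real.pi))⁻¹ * (1 - x ^ 2 / 2)).intervalIntegrable
      _ _)
    (continuous_gaussianPDFReal.intervalIntegrable _ _) fun x _ => by
      rw [gaussianPDFReal_zero_one]
      refine mul_le_mul_of_nonneg_left ?_ (by positivity)
      linarith [Real.add_one_le_exp (-x ^ 2 / 2)]
  refine lt_of_lt_of_le ?_ h1
  have h2 : ∫ x in (-1 : ℝ)..1, (√(2 * Real.pi))⁻¹ * (1 - x ^ 2 / 2) =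
      (√(2 * Real.pi))⁻¹ * (5 / 3) := by
    rw [intervalIntegral.integral_const_mul, intervalIntegral.integral_sub (by simp)
      ((by fun_prop : Continuous fun x : ℝ => x ^ 2 / 2).intervalIntegrable _ _)]
    simp [integral_pow]
    norm_num
  have h3 : √(2 * Real.pi) < 10 / 3 := by
    rw [Real.sqrt_lt' (by norm_num)]
    linarith [Real.pi_lt_d2]
  have h4 : 0 < √(2 * Real.pi) := by positivity
  rw [h2, inv_mul_eq_div, lt_div_iff₀ h4]
  linarith

/-- The lower bound on `φ(g⁻¹(b))` is more than what `Regular` requires. -/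
lemma sq_le_of_bound {b m f : ℝ} (hb1 : b < 1) (hm : m < b)
    (h : (1 - m) ^ 2 * (1 - b) / (2 - (b + m)) ≤ f) : (1 - b) ^ 2 ≤ 2 * f := by
  have hd : 0 < 2 - (b + m) := by linarith
  rw [div_le_iff₀ hd] at h
  have h1 : 0 < 1 - b := by linarith
  -- Here 2 - (b + m) = (1 - b) + (1 - m), and 1 - b < 1 - m.
  have h2 : (1 - b) * (2 - (b + m)) ≤ 2 * (1 - m) ^ 2 := by nlinarith
  have h3 := mul_le_mul_of_nonneg_left h2 h1.le
  refine le_of_mul_le_mul_right ?_ hd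
  linarith

end RobustReg

end

theorem theorem6p3 (p : ℕ) (hp : 0 < p) :
    -- domination of the S-estimate, for every loss function that satisfies the conditions
    (∀ (ρ : ℝ → ℝ) (b σM : ℝ), RobustReg.IsLoss ρ → 0 < b → b < 1 →
      RobustReg.IsUnimodalAt ρ σM →
      RobustReg.g ρ σM < b →
      ConvexOn ℝ (Set.Ioi 0) (RobustReg.g ρ) →
      (1 - RobustReg.g ρ σM) ^ 2 * (1 - b) / (2 - (b + RobustReg.g ρ σM)) ≤
        RobustReg.phi ρ (RobustReg.sigma ρ b 0) →
      -- the inverse of `g` at `b` exists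
      (0 < RobustReg.sigma ρ b 0 ∧ RobustReg.g ρ (RobustReg.sigma ρ b 0) = b) ∧
      -- `c_o = 1 / φ(σ_{b,0})`
      IsGLB (RobustReg.cSet ρ b) (1 / RobustReg.phi ρ (RobustReg.sigma ρ b 0)) ∧
      -- the range of tuning constants is not empty
      (0 < Real.log (σM / RobustReg.sigma ρ b 0) / (b - RobustReg.g ρ σM) ∧
        Real.log (σM / RobustReg.sigma ρ b 0) / (b - RobustReg.g ρ σM) <
          1 / RobustReg.phi ρ (RobustReg.sigma ρ b 0)) ∧
      (∀ c : ℝ, Real.log (σM / RobustReg.sigma ρ b 0) / (b - RobustReg.g ρ σM) < c →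
        c ≤ 1 / RobustReg.phi ρ (RobustReg.sigma ρ b 0) →
        RobustReg.CMDominatesS p ρ b c) ∧
      RobustReg.SInadmissible p ρ b) ∧
    -- the quantile estimates
    (∀ α : ℝ, 0 < α → α < (ProbabilityTheory.gaussianReal 0 1).real {z : ℝ | |z| < 1} →
      RobustReg.SInadmissible p RobustReg.quantLoss (1 - α)) ∧
    -- the least median of squares estimate
    RobustReg.SInadmissible p RobustReg.quantLoss (1 / 2) := by
  refine ⟨fun ρ b σM hρ hb hb1 hu hg hconv hφ => ?_, fun α h0 h1 =>
    RobustReg.sInadmissible_quantLoss hp h0 h1, ?_⟩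
  · obtain ⟨s₀, hR⟩ := RobustReg.exists_regular hρ hb hb1 hu hg hconv fun s hs hsb => by
      have hσ : RobustReg.sigma ρ b 0 = s := by
        rw [RobustReg.sigma, sub_zero, sub_zero, div_one]
        exact RobustReg.gInv_eq (RobustReg.g_strictAnti hρ hconv hu.pos (hg.trans hb1)) hs hsb
      rw [hσ] at hφ
      exact RobustReg.sq_le_of_bound hb1 hg hφ
    rw [hR.sigma_zero]
    exact ⟨⟨hR.pos, hR.g_eq⟩, hR.isGLB_cSet, ⟨hR.ratio_log_pos, hR.ratio_log_lt⟩,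
      fun c hc₁ hcφ => hR.cmDominatesS hp hc₁ hcφ, hR.sInadmissible hp⟩
  · have := RobustReg.sInadmissible_quantLoss hp one_half_pos
      RobustReg.half_lt_gaussianReal_abs_lt_one
    rwa [sub_half] at this
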